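/- Let $U$ be a compact Lie group with Lie algebra $\mathfrak u$, realised as a group of unitary operators on a finite-dimensional complex inner product space $V$, and let $U^{\mathbb C}=U\exp(\mathbf i\mathfrak u)\subset GL(V)$ be its complexification. Let $B$ be an $\mathrm{Ad}(U^{\mathbb C})$-invariant complex symmetric bilinear form on $\mathfrak u^{\mathbb C}=\mathfrak u\oplus\mathbf i\mathfrak u$ whose real part $\langle\cdot,\cdot\rangle$ is negative definite on $\mathfrak u$ (hence positive definite on $\mathbf i\mathfrak u$) and satisfies $\langle\mathfrak u,\mathbf i\mathfrak u\rangle=0$. Let $G\subset U^{\mathbb C}$ be a closed compatible subgroup, i.e. $G=K\exp(\mathfrak p)$ with $K=G\cap U$ and $\mathfrak p=\mathfrak g\cap\mathbf i\mathfrak u$, where $\mathfrak g$ is the Lie algebra of $G$. Equip $M=G/K$ with the $G$-invariant Riemannian metric that is $\langle\cdot,\cdot\rangle$ on $T_{K}M=\mathfrak p$, and let $d$ be its distance. Its unit speed geodesics are $\gamma(t)=g\exp(t\beta)K$ with $g\in G$, $\beta\in\mathfrak p$, $\|\beta\|=1$; two of them are equivalent, $\gamma\sim\gamma'$, if $\sup_{t>0}d(\gamma(t),\gamma'(t))<\infty$,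 and the Tits boundary $\partial_\infty M$ is the set of equivalence classes $[\gamma]$. Let $Z$ be a Kähler manifold with complex structure $J$, Riemannian metric $h$ and Kähler form $\omega(\cdot,\cdot)=h(J\cdot,\cdot)$, on which $U^{\mathbb C}$ acts holomorphically. Assume that $\omega$ is $U$-invariant and that there is a $U$-equivariant momentum map $\mu:Z\to\mathfrak u^*$, i.e. $d\mu^\xi=i_{\xi_Z}\omega$ for $\xi\in\mathfrak u$, where $\mu^\xi(z)=\mu(z)(\xi)$ and $\xi_Z$ is the fundamental vector field of $\xi$. Let $\mu_{\mathfrak p}:Z\to\mathfrak p$ be the gradient map, $\langle\mu_{\mathfrak p}(z),\beta\rangle=\mu^{-\mathbf i\beta}(z)$ for $\beta\in\mathfrak p$. Let $X\subset Z$ be a $G$-stable locally closed real submanifold, with the induced Riemannian metric and its geodesic distance $d_X$. For $x\in X$ let $\Phi(x,\cdot):G\to\mathbb R$ be the Kempf–Ness function, $$\Phi(x,k\exp(\xi))=\int_0^1\langle\mu_{\mathfrak p}(\exp(t\xi)x),\xi\rangle\,dt\qquad(k\in K,\ \xi\in\mathfrak p),$$ and let $\Phi_x:M\to\mathbb R$,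 $\Phi_x(gK)=\Phi(x,g^{-1})$. Assume that $X$ is connected and that there are $x_0\in X$ and $C>0$ with $$\|\beta_X(x)\|\le C\,\|\beta\|\,(1+d_X(x_0,x))\qquad\text{for all }x\in X,\ \beta\in\mathfrak p,$$ where $\beta_X$ is the fundamental vector field of $\beta$ on $X$. Then for every $x\in X$ the function $\Phi_x\circ\gamma$ is differentiable for every unit speed geodesic $\gamma$ of $M$, and $$\lambda_x([\gamma])=\lim_{t\to\infty}\frac{d}{dt}\Phi_x(\gamma(t))=\lim_{t\to\infty}\frac{\Phi_x(\gamma(t))}{t}$$ is a well-defined function $\lambda_x:\partial_\infty M\to\mathbb R\cup\{\infty\}$: both limits exist in $\mathbb R\cup\{\infty\}$, they agree, and they take the same value on equivalent geodesics. -/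

import Mathlib

open scoped ContDiff Manifold Topology ENNReal NNReal
open Filter Set MeasureTheory

noncomputable section

namespace KempfNess

/-! ### Closed linear groups: exponential map and Lie algebra -/

section LinearGroups

variable {V : Type*} [NormedAddCommGroup V] [InnerProductSpace ℂ V] [FiniteDimensional ℂ V]

/-- The exponential map `𝔤𝔩(V) → GL(V)`. -/
def expU (A : V →L[ℂ] V) : (V →L[ℂ] V)ˣ :=
  letI : NormedAlgebra ℚ (V →L[ℂ] V) := NormedAlgebra.restrictScalars ℚ ℂ (V →L[ℂ] V)
  haveI : CompleteSpace V := FiniteDimensional.complete ℂ V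
  { val := NormedSpace.exp A
    inv := NormedSpace.exp (-A)
    val_inv := by
      rw [← NormedSpace.exp_add_of_commute (Commute.neg_right (Commute.refl A))]
      simp
    inv_val := by
      rw [← NormedSpace.exp_add_of_commute (Commute.neg_left (Commute.refl A))]
      simp }

theorem norm_pow_sub_pow_le {A : Type*} [NormedRing A] (h1 : ‖(1 : A)‖ ≤ 1) (X Y : A) {M : ℝ}
    (hX : ‖X‖ ≤ M) (hY : ‖Y‖ ≤ M) (n : ℕ) :
    ‖X ^ (n + 1) - Y ^ (n + 1)‖ ≤ (n + 1) * M ^ n * ‖X - Y‖ := by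
  have hM : 0 ≤ M := (norm_nonneg _).trans hX
  have hp : ∀ k : ℕ, ‖X ^ k‖ ≤ M ^ k := by
    intro k
    induction k with
    | zero => simpa using h1
    | succ k ih =>
      rw [pow_succ, pow_succ]
      exact (norm_mul_le _ _).trans (mul_le_mul ih hX (norm_nonneg _) (pow_nonneg hM _))
  induction n with
  | zero => simp
  | succ n ih =>
    have : X ^ (n+1+1) - Y ^ (n+1+1) = X ^ (n+1) * (X - Y) + (X ^ (n+1) - Y ^ (n+1)) * Y := by
      rw [pow_succ X (n+1), pow_succ Y (n+1)]; noncomm_ring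
    rw [this]
    refine (norm_add_le _ _).trans ?_
    have a1 := (norm_mul_le (X ^ (n+1)) (X - Y)).trans
      (mul_le_mul_of_nonneg_right (hp (n+1)) (norm_nonneg _))
    have a2 := (norm_mul_le (X ^ (n+1) - Y ^ (n+1)) Y).trans
      (mul_le_mul ih hY (norm_nonneg _) (by positivity))
    refine (add_le_add a1 a2).trans (le_of_eq ?_)
    push_cast; ring

theorem tendsto_trotter {R : Type*} [NormedRing R] [NormedAlgebra ℝ R] [CompleteSpace R]
    (h1 : ‖(1 : R)‖ ≤ 1) (A B : R) :
    Tendsto (fun n : ℕ => (NormedSpace.exp (((n : ℝ) + 1)⁻¹ • A) *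
      NormedSpace.exp (((n : ℝ) + 1)⁻¹ • B)) ^ (n + 1)) atTop (𝓝 (NormedSpace.exp (A + B))) := by
  let _ : NormedAlgebra ℚ R := NormedAlgebra.restrictScalars ℚ ℝ R
  set f : ℝ → R := fun t => NormedSpace.exp (t • A) * NormedSpace.exp (t • B) with hf
  set g : ℝ → R := fun t => NormedSpace.exp (t • (A + B)) with hg
  have hf' : HasDerivAt f (A + B) 0 := by
    have := (hasDerivAt_exp_smul_const A (0 : ℝ)).mul (hasDerivAt_exp_smul_const B (0 : ℝ))
    simp only [zero_smul, NormedSpace.exp_zero, one_mul, mul_one] at this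
    exact this
  have hg' : HasDerivAt g (A + B) 0 := by
    have := hasDerivAt_exp_smul_const (A + B) (0 : ℝ)
    simp only [zero_smul, NormedSpace.exp_zero, one_mul] at this
    exact this
  have hlim : Tendsto (fun n : ℕ => ((n : ℝ) + 1)⁻¹) atTop (𝓝 0) := by
    simpa using tendsto_one_div_add_atTop_nhds_zero_nat (𝕜 := ℝ)
  have hb : ∀ k : ℝ → R, HasDerivAt k (A + B) 0 → k 0 = 1 →
      ∀ᶠ n : ℕ in atTop, ‖k ((n : ℝ) + 1)⁻¹‖ ≤ 1 + (‖A + B‖ + 1) * ((n : ℝ) + 1)⁻¹ := by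
    intro k hk h0
    have := (hk.isLittleO.def (c := 1) one_pos)
    filter_upwards [hlim.eventually this] with n hn
    have hpos : (0 : ℝ) < ((n : ℝ) + 1)⁻¹ := by positivity
    simp only [h0, sub_zero, one_mul, Real.norm_eq_abs, abs_of_pos hpos] at hn
    have e : k ((n : ℝ) + 1)⁻¹ = (k ((n : ℝ) + 1)⁻¹ - 1 - ((n : ℝ) + 1)⁻¹ • (A + B)) + 1
      + ((n : ℝ) + 1)⁻¹ • (A + B) := by abel
    rw [e]
    refine (norm_add₃_le).trans ?_
    rw [norm_smul, Real.norm_eq_abs, abs_of_pos hpos]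
    linarith
  have hd : Tendsto (fun n : ℕ => ((n : ℝ) + 1) * ‖f ((n : ℝ) + 1)⁻¹ - g ((n : ℝ) + 1)⁻¹‖)
      atTop (𝓝 0) := by
    have h0 : HasDerivAt (fun t => f t - g t) 0 0 := by
      have := hf'.sub hg'
      rw [sub_self] at this
      exact this
    rw [Metric.tendsto_nhds]
    intro ε hε
    have := h0.isLittleO.def (c := ε / 2) (by positivity)
    filter_upwards [hlim.eventually this] with n hn
    have hpos : (0 : ℝ) < ((n : ℝ) + 1)⁻¹ := by positivity
    have hz : f 0 - g 0 = 0 := by simp [hf, hg]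
    simp only [hz, sub_zero, smul_zero, Real.norm_eq_abs, abs_of_pos hpos] at hn
    rw [Real.dist_eq, sub_zero, abs_of_nonneg (by positivity)]
    have hp' : (0 : ℝ) < (n : ℝ) + 1 := by positivity
    calc ((n : ℝ) + 1) * ‖f ((n : ℝ) + 1)⁻¹ - g ((n : ℝ) + 1)⁻¹‖
        ≤ ((n : ℝ) + 1) * (ε / 2 * ((n : ℝ) + 1)⁻¹) := by gcongr
      _ = ε / 2 := by field_simp
      _ < ε := by linarith
  set C : ℝ := ‖A + B‖ + 1 with hC
  have hgp : ∀ n : ℕ, g ((n : ℝ) + 1)⁻¹ ^ (n + 1) = NormedSpace.exp (A + B) := by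
    intro n
    rw [hg, ← NormedSpace.exp_nsmul, ← Nat.cast_smul_eq_nsmul ℝ, smul_smul]
    have hp' : (n : ℝ) + 1 ≠ 0 := by positivity
    push_cast
    rw [mul_inv_cancel₀ hp', one_smul]
  rw [tendsto_iff_norm_sub_tendsto_zero]
  have hup : Tendsto (fun n : ℕ => Real.exp C *
      (((n : ℝ) + 1) * ‖f ((n : ℝ) + 1)⁻¹ - g ((n : ℝ) + 1)⁻¹‖)) atTop (𝓝 0) := by
    simpa using hd.const_mul (Real.exp C)
  refine squeeze_zero' (Eventually.of_forall fun n => norm_nonneg _) ?_ hup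
  filter_upwards [hb f hf' (by simp [hf]), hb g hg' (by simp [hg])] with n h2 h3
  rw [← hgp n]
  have hM : (1 + C * ((n : ℝ) + 1)⁻¹) ^ n ≤ Real.exp C := by
    have hC0 : 0 ≤ C := by positivity
    have hp' : (0 : ℝ) < (n : ℝ) + 1 := by positivity
    calc (1 + C * ((n : ℝ) + 1)⁻¹) ^ n ≤ (Real.exp (C * ((n : ℝ) + 1)⁻¹)) ^ n := by
          gcongr
          linarith [Real.add_one_le_exp (C * ((n : ℝ) + 1)⁻¹)]
      _ = Real.exp (n * (C * ((n : ℝ) + 1)⁻¹)) := by rw [← Real.exp_nat_mul]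
      _ ≤ Real.exp C := by
          apply Real.exp_le_exp.2
          rw [← div_eq_mul_inv, mul_div_assoc', div_le_iff₀ hp']
          nlinarith
  refine (norm_pow_sub_pow_le h1 _ _ h2 h3 n).trans ?_
  rw [mul_comm ((n : ℝ) + 1), mul_assoc]
  gcongr

theorem expU_add_mem {H : Subgroup (V →L[ℂ] V)ˣ} (hH : IsClosed (H : Set (V →L[ℂ] V)ˣ))
    {A B : V →L[ℂ] V} (hA : ∀ t : ℝ, expU (t • A) ∈ H) (hB : ∀ t : ℝ, expU (t • B) ∈ H) :
    expU (A + B) ∈ H := by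
  have : CompleteSpace V := FiniteDimensional.complete ℂ V
  have h1 : ‖(1 : V →L[ℂ] V)‖ ≤ 1 := ContinuousLinearMap.norm_id_le
  have hT := tendsto_trotter h1 A B
  have hT' := tendsto_trotter h1 (-B) (-A)
  let w : ℕ → (V →L[ℂ] V)ˣ := fun n =>
    (expU (((n : ℝ) + 1)⁻¹ • A) * expU (((n : ℝ) + 1)⁻¹ • B)) ^ (n + 1)
  have hw : Tendsto w atTop (𝓝 (expU (A + B))) := by
    rw [(Units.isInducing_embedProduct).tendsto_nhds_iff]
    refine Tendsto.prodMk_nhds ?_ ?_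
    · exact hT
    · refine (MulOpposite.continuous_op.tendsto _).comp ?_
      have e : (((expU (A + B))⁻¹ : (V →L[ℂ] V)ˣ) : V →L[ℂ] V) = NormedSpace.exp (-B + -A) := by
        change NormedSpace.exp (-(A + B)) = _
        congr 1; abel
      rw [e]
      refine hT'.congr fun n => ?_
      simp only [w, ← inv_pow, mul_inv_rev, Units.val_pow_eq_pow_val, Units.val_mul]
      change _ = (NormedSpace.exp (-(((n : ℝ) + 1)⁻¹ • B)) *
        NormedSpace.exp (-(((n : ℝ) + 1)⁻¹ • A))) ^ (n + 1)
      simp only [smul_neg]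
  exact hH.mem_of_tendsto hw (Eventually.of_forall fun n => H.pow_mem (H.mul_mem (hA _) (hB _)) _)

/-- The Lie algebra `{A | exp (t A) ∈ H for all real t}` of a closed subgroup `H` of `GL(V)`. -/
def lieAlg (H : Subgroup (V →L[ℂ] V)ˣ) (hH : IsClosed (H : Set (V →L[ℂ] V)ˣ)) :
    Submodule ℝ (V →L[ℂ] V) where
  carrier := {A | ∀ t : ℝ, expU (t • A) ∈ H}
  zero_mem' := by
    intro t
    have : expU (t • (0 : V →L[ℂ] V)) = 1 := by
      apply Units.ext
      change NormedSpace.exp (t • (0 : V →L[ℂ] V)) = 1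
      simp
    rw [this]; exact H.one_mem
  add_mem' := by
    intro A B hA hB t
    rw [smul_add]
    refine expU_add_mem hH (fun s => ?_) (fun s => ?_)
    · rw [smul_smul]; exact hA _
    · rw [smul_smul]; exact hB _
  smul_mem' := by
    intro c A hA t
    rw [smul_smul]; exact hA _

/-- `𝔭 = 𝔤 ∩ i𝔲`. -/
def pPart (U G : Subgroup (V →L[ℂ] V)ˣ) (hU : IsClosed (U : Set (V →L[ℂ] V)ˣ))
    (hG : IsClosed (G : Set (V →L[ℂ] V)ˣ)) : Submodule ℝ (V →L[ℂ] V) :=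
  lieAlg G hG ⊓
    (lieAlg U hU).comap (DistribSMul.toLinearMap ℝ (V →L[ℂ] V) (-Complex.I))

end LinearGroups

/-! ### Compatible subgroups of complex reductive groups -/

/-- A compact Lie group `U` (realised as a group of unitary operators, which is possible for every
compact Lie group), its complexification `U^ℂ = U exp(i𝔲)`, a compatible subgroup `G ⊆ U^ℂ`, and
an `Ad(U^ℂ)`-invariant inner product of Euclidean type on `𝔲^ℂ = 𝔲 ⊕ i𝔲`. -/
structure CompatibleGroup (V : Type*) [NormedAddCommGroup V] [InnerProductSpace ℂ V]
    [FiniteDimensional ℂ V] where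
  /-- the compact group `U` -/
  U : Subgroup (V →L[ℂ] V)ˣ
  isCompact_U : IsCompact (U : Set (V →L[ℂ] V)ˣ)
  unitary_U : ∀ u ∈ U, ∀ v : V, ‖(u : V →L[ℂ] V) v‖ = ‖v‖
  /-- the complexification `U^ℂ` of `U` -/
  UC : Subgroup (V →L[ℂ] V)ˣ
  mem_UC : ∀ g, g ∈ UC ↔ ∃ u ∈ U, ∃ ξ ∈ lieAlg U isCompact_U.isClosed, g = u * expU (Complex.I • ξ)
  /-- the compatible subgroup `G` -/
  G : Subgroup (V →L[ℂ] V)ˣ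
  G_le : G ≤ UC
  isClosed_G : IsClosed (G : Set (V →L[ℂ] V)ˣ)
  /-- `G = K exp(𝔭)` with `K = G ∩ U` -/
  compatible : ∀ g ∈ G, ∃ k ∈ G ⊓ U, ∃ β ∈ pPart U G isCompact_U.isClosed isClosed_G,
    g = k * expU β
  /-- the inner product on `𝔲^ℂ`; only its values on `𝔲^ℂ` matter. As `𝔲^ℂ` is the complex span
  of `𝔲`, the conditions below need only be imposed on `𝔲`. -/
  B : (V →L[ℂ] V) →ₗ[ℂ] (V →L[ℂ] V) →ₗ[ℂ] ℂ
  B_symm : ∀ ξ ∈ lieAlg U isCompact_U.isClosed, ∀ η ∈ lieAlg U isCompact_U.isClosed,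
    B ξ η = B η ξ
  B_invariant : ∀ g ∈ UC, ∀ ξ ∈ lieAlg U isCompact_U.isClosed,
    ∀ η ∈ lieAlg U isCompact_U.isClosed,
    B ((g : V →L[ℂ] V) * ξ * ((g⁻¹ : (V →L[ℂ] V)ˣ) : V →L[ℂ] V))
      ((g : V →L[ℂ] V) * η * ((g⁻¹ : (V →L[ℂ] V)ˣ) : V →L[ℂ] V)) = B ξ η
  /-- `⟨·,·⟩ = Re B` is negative definite on `𝔲` (hence positive definite on `i𝔲`) -/
  B_neg : ∀ ξ ∈ lieAlg U isCompact_U.isClosed, ξ ≠ 0 → (B ξ ξ).re < 0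
  /-- `⟨𝔲, i𝔲⟩ = 0` -/
  B_orth : ∀ ξ ∈ lieAlg U isCompact_U.isClosed, ∀ η ∈ lieAlg U isCompact_U.isClosed,
    (B ξ (Complex.I • η)).re = 0

namespace CompatibleGroup

variable {V : Type*} [NormedAddCommGroup V] [InnerProductSpace ℂ V] [FiniteDimensional ℂ V]
  (S : CompatibleGroup V)

/-- The Lie algebra `𝔲` of `U`. -/
def u : Submodule ℝ (V →L[ℂ] V) := lieAlg S.U S.isCompact_U.isClosed

/-- The subspace `𝔭 = 𝔤 ∩ i𝔲` of the Lie algebra `𝔤` of `G`. -/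
def p : Submodule ℝ (V →L[ℂ] V) := pPart S.U S.G S.isCompact_U.isClosed S.isClosed_G

theorem U_le : S.U ≤ S.UC := by
  intro u hu
  refine (S.mem_UC u).2 ⟨u, hu, 0, Submodule.zero_mem _, ?_⟩
  have : expU (Complex.I • (0 : V →L[ℂ] V)) = 1 := by
    apply Units.ext
    change NormedSpace.exp (Complex.I • (0 : V →L[ℂ] V)) = 1
    simp
  rw [this, mul_one]

theorem exp_mem_of_u (ξ : S.u) (t : ℝ) : expU (t • (ξ : V →L[ℂ] V)) ∈ S.UC := S.U_le (ξ.2 t)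

theorem exp_mem_of_p (β : S.p) (t : ℝ) : expU (t • (β : V →L[ℂ] V)) ∈ S.G := β.2.1 t

/-- `-iβ ∈ 𝔲` for `β ∈ 𝔭`. -/
def negI (β : S.p) : S.u := ⟨-Complex.I • (β : V →L[ℂ] V), β.2.2⟩

/-- The norm `‖β‖ = ⟨β, β⟩^{1/2}`, used for `β ∈ 𝔭`, where `⟨·,·⟩ = Re B`. -/
def normP (β : V →L[ℂ] V) : ℝ := Real.sqrt (S.B β β).re

/-- The one-parameter subgroup `t ↦ exp(tβ)` of `G`, for `β ∈ 𝔭`. -/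
def expG (β : S.p) (t : ℝ) : S.G := ⟨expU (t • (β : V →L[ℂ] V)), S.exp_mem_of_p β t⟩

/-- `K = G ∩ U`, as a subgroup of `G`. -/
def K : Subgroup S.G := S.U.subgroupOf S.G

/-- The symmetric space `M = G/K`. -/
abbrev M : Type _ := S.G ⧸ S.K

/-- The left logarithmic derivative `c(t)⁻¹ c'(t)` of a curve in `G`. -/
def velocity (c : ℝ → S.G) (t : ℝ) : V →L[ℂ] V :=
  (((c t : (V →L[ℂ] V)ˣ)⁻¹ : (V →L[ℂ] V)ˣ) : V →L[ℂ] V) *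
    deriv (fun s => ((c s : (V →L[ℂ] V)ˣ) : V →L[ℂ] V)) t

/-- The distance on `M = G/K` of the `G`-invariant Riemannian metric which is `⟨·,·⟩` on
`T_o M = 𝔭`: the infimum of the lengths of the `C¹` curves in `M` from `a` to `b`. Every `C¹` curve
in `M` is `t ↦ c(t)K` for a horizontal `C¹` curve `c` in `G`, that is one with `c⁻¹c' ∈ 𝔭`, and
its speed is then `‖c⁻¹c'‖`. -/
def distM (a b : S.M) : ℝ≥0∞ :=
  ⨅ (c : ℝ → S.G) (_ : ContDiff ℝ 1 (fun t => ((c t : (V →L[ℂ] V)ˣ) : V →L[ℂ] V)))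
    (_ : ∀ t, S.velocity c t ∈ S.p) (_ : (QuotientGroup.mk (c 0) : S.M) = a)
    (_ : (QuotientGroup.mk (c 1) : S.M) = b),
    ∫⁻ t in Icc (0 : ℝ) 1, ENNReal.ofReal (S.normP (S.velocity c t))

/-- The geodesic `t ↦ g exp(tβ) K` of `M`. -/
def geodesic (g : S.G) (β : S.p) (t : ℝ) : S.M := QuotientGroup.mk (g * S.expG β t)

/-- The unit speed geodesics of `M`. -/
def UnitGeodesic : Type _ :=
  {γ : ℝ → S.M // ∃ (g : S.G) (β : S.p), S.normP β = 1 ∧ γ = S.geodesic g β}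

/-- Equivalence `γ ∼ γ'` of unit speed geodesics: `sup_{t > 0} d(γ(t), γ'(t)) < ∞`. -/
def Asymptotic (γ γ' : S.UnitGeodesic) : Prop :=
  ∃ Q : ℝ≥0, ∀ t : ℝ, 0 < t → S.distM (γ.1 t) (γ'.1 t) ≤ Q

/-- The Tits boundary `∂_∞ M`: unit speed geodesics modulo equivalence. -/
def TitsBoundary : Type _ := Quot S.Asymptotic

/-- A vector `ξ ∈ 𝔭` with `g ∈ K exp(ξ)`; it exists as `G` is compatible, and it is unique. -/
def polar (g : S.G) : S.p :=
  Classical.epsilon fun ξ : S.p => ∃ k ∈ S.K, g = k * S.expG ξ 1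

theorem polar_mul_left (k : S.G) (hk : k ∈ S.K) (g : S.G) : S.polar (k * g) = S.polar g := by
  unfold polar
  congr 1
  funext ξ
  apply propext
  constructor
  · rintro ⟨k', hk', h⟩
    exact ⟨k⁻¹ * k', S.K.mul_mem (S.K.inv_mem hk) hk', by rw [mul_assoc, ← h]; simp⟩
  · rintro ⟨k', hk', h⟩
    exact ⟨k * k', S.K.mul_mem hk hk', by rw [mul_assoc, ← h]⟩

end CompatibleGroup

/-! ### Hamiltonian actions on Kähler manifolds -/

/-- A complex manifold is a real analytic (in particular smooth) real manifold. -/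
instance realManifold {E Z : Type*} [NormedAddCommGroup E] [NormedSpace ℂ E] [TopologicalSpace Z]
    [ChartedSpace E Z] [IsManifold 𝓘(ℂ, E) ω Z] : IsManifold 𝓘(ℝ, E) ω Z := by
  refine isManifold_of_contDiffOn 𝓘(ℝ, E) ω Z fun e e' he he' => ?_
  have h := (contDiffGroupoid ω 𝓘(ℂ, E)).compatible he he'
  rw [contDiffGroupoid, mem_groupoid_of_pregroupoid] at h
  exact h.1.restrict_scalars ℝ

section Kahler

variable {E Z : Type*} [NormedAddCommGroup E] [NormedSpace ℂ E] [TopologicalSpace Z]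
  [ChartedSpace E Z] [IsManifold 𝓘(ℂ, E) ω Z]

/-- The complex structure `J` on the tangent spaces of a complex manifold. -/
def J (z : Z) (v : TangentSpace 𝓘(ℝ, E) z) : TangentSpace 𝓘(ℝ, E) z :=
  (Complex.I • (show E from v) : E)

variable (E Z) in
/-- Smooth Riemannian metrics on (the real manifold underlying) `Z`. -/
abbrev Metric : Type _ :=
  Bundle.ContMDiffRiemannianMetric 𝓘(ℝ, E) ∞ E (fun z : Z => TangentSpace 𝓘(ℝ, E) z)

/-- The two-form `ω(v, w) = h(Jv, w)` of a metric `h`. -/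
def form (h : Metric E Z) (z : Z) (v w : TangentSpace 𝓘(ℝ, E) z) : ℝ := h.inner z (J z v) w

/-- The expression of `ω` in a chart `φ`, as a function on `φ.target ⊆ E`. -/
def chartForm (h : Metric E Z) (φ : OpenPartialHomeomorph Z E) (b c : E) (e : E) : ℝ :=
  form h (φ.symm e) (mfderiv 𝓘(ℝ, E) 𝓘(ℝ, E) φ.symm e b) (mfderiv 𝓘(ℝ, E) 𝓘(ℝ, E) φ.symm e c)

/-- `h` is a Kähler metric: it is `J`-invariant and `dω = 0` in every chart. -/
structure IsKahler (h : Metric E Z) : Prop where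
  hermitian : ∀ (z : Z) (v w : TangentSpace 𝓘(ℝ, E) z), h.inner z (J z v) (J z w) = h.inner z v w
  closed : ∀ φ ∈ atlas E Z, ∀ e ∈ φ.target, ∀ a b c : E,
    fderiv ℝ (chartForm h φ b c) e a + fderiv ℝ (chartForm h φ c a) e b +
      fderiv ℝ (chartForm h φ a b) e c = 0

/-- The action of the complex linear group `H ⊆ GL(V)` on `Z` is holomorphic: locally, the action
map `H × Z → Z` is the restriction of a holomorphic map defined on an open subset of
`𝔤𝔩(V) × Z`. -/
def IsHolomorphicAction (E : Type*) {Z : Type*} [NormedAddCommGroup E] [NormedSpace ℂ E]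
    [TopologicalSpace Z] [ChartedSpace E Z] {V : Type*} [NormedAddCommGroup V]
    [InnerProductSpace ℂ V] (H : Subgroup (V →L[ℂ] V)ˣ) [MulAction H Z] : Prop :=
  ∀ (g₀ : H) (z₀ : Z), ∃ Ψ : (V →L[ℂ] V) × Z → Z,
    ContMDiffAt (𝓘(ℂ, V →L[ℂ] V).prod 𝓘(ℂ, E)) 𝓘(ℂ, E) ω Ψ
      (((g₀ : (V →L[ℂ] V)ˣ) : V →L[ℂ] V), z₀) ∧
    ∀ᶠ q in 𝓝 (((g₀ : (V →L[ℂ] V)ˣ) : V →L[ℂ] V), z₀),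
      ∀ g : H, ((g : (V →L[ℂ] V)ˣ) : V →L[ℂ] V) = q.1 → Ψ q = g • q.2

/-- The value at `z` of the fundamental vector field of `A`, where `exp(tA) ∈ H` for all `t`. -/
def fundVF (E : Type*) {Z : Type*} [NormedAddCommGroup E] [NormedSpace ℂ E]
    [TopologicalSpace Z] [ChartedSpace E Z] {V : Type*} [NormedAddCommGroup V]
    [InnerProductSpace ℂ V] [FiniteDimensional ℂ V] (H : Subgroup (V →L[ℂ] V)ˣ) [MulAction H Z]
    (A : V →L[ℂ] V) (hA : ∀ t : ℝ, expU (t • A) ∈ H) (z : Z) : TangentSpace 𝓘(ℝ, E) z :=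
  (mfderiv 𝓘(ℝ, ℝ) 𝓘(ℝ, E) (fun t : ℝ => (⟨expU (t • A), hA t⟩ : H) • z) 0 (1 : ℝ) : E)

/-- `X` is a (locally closed, i.e. embedded) real submanifold of `Z`: around each of its points it
is a real linear slice in some smooth chart of `Z`. -/
def IsRealSubmanifold (E : Type*) {Z : Type*} [NormedAddCommGroup E] [NormedSpace ℂ E]
    [TopologicalSpace Z] [ChartedSpace E Z] (X : Set Z) : Prop :=
  ∀ x ∈ X, ∃ φ ∈ IsManifold.maximalAtlas 𝓘(ℝ, E) ∞ Z, x ∈ φ.source ∧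
    ∃ W : Submodule ℝ E, φ '' (X ∩ φ.source) = φ.target ∩ W

end Kahler

/-- A Kähler structure on the complex manifold `Z`, on which `U^ℂ` acts holomorphically, such that
the Kähler form is `U`-invariant and the `U`-action is Hamiltonian, with momentum map `μ`. -/
structure HamiltonianKahler {V : Type*} [NormedAddCommGroup V] [InnerProductSpace ℂ V]
    [FiniteDimensional ℂ V] (S : CompatibleGroup V) (E Z : Type*) [NormedAddCommGroup E]
    [NormedSpace ℂ E] [TopologicalSpace Z] [ChartedSpace E Z] [IsManifold 𝓘(ℂ, E) ω Z]
    [MulAction S.UC Z] where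
  /-- the Kähler metric -/
  h : Metric E Z
  isKahler : IsKahler h
  holomorphic : IsHolomorphicAction E (Z := Z) S.UC
  invariant : ∀ g : S.UC, (g : (V →L[ℂ] V)ˣ) ∈ S.U → ∀ (z : Z) (v w : TangentSpace 𝓘(ℝ, E) z),
    form h (g • z) (mfderiv 𝓘(ℝ, E) 𝓘(ℝ, E) (fun y : Z => g • y) z v)
      (mfderiv 𝓘(ℝ, E) 𝓘(ℝ, E) (fun y : Z => g • y) z w) = form h z v w
  /-- the momentum map -/
  μ : Z → Module.Dual ℝ S.u
  contMDiff_μ : ∀ ξ : S.u, ContMDiff 𝓘(ℝ, E) 𝓘(ℝ, ℝ) ∞ (fun z => μ z ξ)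
  /-- `μ(gz)(Ad(g)ξ) = μ(z)(ξ)` for `g ∈ U` -/
  equivariant : ∀ g : S.UC, (g : (V →L[ℂ] V)ˣ) ∈ S.U → ∀ (z : Z) (ξ η : S.u),
    (η : V →L[ℂ] V) = ((g : (V →L[ℂ] V)ˣ) : V →L[ℂ] V) * ξ *
      (((g : (V →L[ℂ] V)ˣ)⁻¹ : (V →L[ℂ] V)ˣ) : V →L[ℂ] V) → μ (g • z) η = μ z ξ
  /-- `dμ^ξ = i_{ξ_Z} ω` -/
  moment : ∀ (ξ : S.u) (z : Z) (w : TangentSpace 𝓘(ℝ, E) z),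
    mfderiv 𝓘(ℝ, E) 𝓘(ℝ, ℝ) (fun y => μ y ξ) z w =
      form h z (fundVF E S.UC ξ (S.exp_mem_of_u ξ) z) w

namespace HamiltonianKahler

variable {V : Type*} [NormedAddCommGroup V] [InnerProductSpace ℂ V] [FiniteDimensional ℂ V]
  {S : CompatibleGroup V} {E Z : Type*} [NormedAddCommGroup E] [NormedSpace ℂ E]
  [TopologicalSpace Z] [ChartedSpace E Z] [IsManifold 𝓘(ℂ, E) ω Z] [MulAction S.UC Z]
  (H : HamiltonianKahler S E Z)

/-- The length `‖v‖ = h(v, v)^{1/2}` of a tangent vector. -/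
def tangentNorm (z : Z) (v : TangentSpace 𝓘(ℝ, E) z) : ℝ := Real.sqrt (H.h.inner z v v)

/-- The geodesic distance of the submanifold `X` with the induced Riemannian metric: the infimum of
the lengths of the `C¹` curves in `X` from `x` to `y`. -/
def distX (X : Set Z) (x y : Z) : ℝ≥0∞ :=
  ⨅ (c : ℝ → Z) (_ : ContMDiff 𝓘(ℝ, ℝ) 𝓘(ℝ, E) 1 c) (_ : ∀ t, c t ∈ X) (_ : c 0 = x)
    (_ : c 1 = y),
    ∫⁻ t in Icc (0 : ℝ) 1,
      ENNReal.ofReal (H.tangentNorm (c t) (mfderiv 𝓘(ℝ, ℝ) 𝓘(ℝ, E) c t (1 : ℝ)))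

/-- The fundamental vector field `β_X` of `β ∈ 𝔭`. -/
def fundP (_H : HamiltonianKahler S E Z) (β : S.p) (x : Z) : TangentSpace 𝓘(ℝ, E) x :=
  fundVF E S.UC β (fun t => S.G_le (S.exp_mem_of_p β t)) x

/-- `X` is connected and there are `x₀ ∈ X` and `C > 0` with
`‖β_X(x)‖ ≤ C ‖β‖ (1 + d_X(x₀, x))` for all `x ∈ X` and `β ∈ 𝔭`. -/
def LinearGrowth (X : Set Z) : Prop :=
  IsConnected X ∧ ∃ x₀ ∈ X, ∃ C : ℝ, 0 < C ∧ ∀ x ∈ X, ∀ β : S.p,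
    ENNReal.ofReal (H.tangentNorm x (H.fundP β x)) ≤
      ENNReal.ofReal (C * S.normP β) * (1 + H.distX X x₀ x)

/-- The action of `g ∈ G ⊆ U^ℂ` on `Z`. -/
def act (_H : HamiltonianKahler S E Z) (g : S.G) (z : Z) : Z := Subgroup.inclusion S.G_le g • z

/-- The gradient map, through its components `⟨μ_𝔭(z), β⟩ = μ^{-iβ}(z)`, `β ∈ 𝔭`. -/
def gradientMap (z : Z) (β : S.p) : ℝ := H.μ z (S.negI β)

/-- The Kempf–Ness function `Φ(x, g)`: for `g = k exp(ξ)` with `k ∈ K` and `ξ ∈ 𝔭` it is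
`∫₀¹ ⟨μ_𝔭(exp(tξ)x), ξ⟩ dt`, the function with `Φ(x, kg) = Φ(x, g)`, `Φ(x, e) = 0` and
`d/dt Φ(x, exp(tξ)) = ⟨μ_𝔭(exp(tξ)x), ξ⟩`. -/
def kempfNess (x : Z) (g : S.G) : ℝ :=
  ∫ t in (0 : ℝ)..1, H.gradientMap (H.act (S.expG (S.polar g) t) x) (S.polar g)

theorem kempfNess_mul_left (x : Z) (k : S.G) (hk : k ∈ S.K) (g : S.G) :
    H.kempfNess x (k * g) = H.kempfNess x g := by
  unfold kempfNess
  rw [S.polar_mul_left k hk g]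

/-- The function `Φ_x : M → ℝ`, `Φ_x(gK) = Φ(x, g⁻¹)`. -/
def kempfNessM (x : Z) : S.M → ℝ :=
  Quotient.lift (fun g : S.G => H.kempfNess x g⁻¹) (by
    intro a b hab
    have h : a⁻¹ * b ∈ S.K := QuotientGroup.leftRel_apply.1 hab
    have e : a⁻¹ = (a⁻¹ * b) * b⁻¹ := by group
    change H.kempfNess x a⁻¹ = H.kempfNess x b⁻¹
    rw [e]
    exact H.kempfNess_mul_left x _ h _)

end HamiltonianKahler

end KempfNess

end

/-! Along a geodesic `t ↦ g exp(tβ)K` the function `Φ_x` is convex. Its derivative is minus the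
`β`-component of the gradient map at `exp(-tβ)g⁻¹x`, and that component is nondecreasing along the
flow of `β`, because its derivative is the squared length of the fundamental field of `-iβ`
(`hasDerivAt_grad_exp`, `monotone_slope`). For a function with monotone derivative both limits exist
and equal the supremum of the derivative, which is not `-∞`.

The derivative formula is the laborious half, since `Φ(x, ·)` is defined by integrating along a
single ray to each point. In exponential coordinates the differential is found in
`exists_hasFDerivAt_kempfNessExp`: the integrand of the differentiated integral is a total
derivative in `t`. Passing to `G` (`hasDerivAt_kempfNess_zero`) only needs the polar part of
`exp(sβ)g` to vary by `O(s)`. This comes from `norm_polar_sub_le`, which rests on operator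
monotonicity of the logarithm.

The same estimate gives independence of the representative. If `γ(t) = g exp(tβ)K` stays at bounded
distance from `γ'(t) = g' exp(tβ')K`, the polar part of `exp(-tβ)g⁻¹g'` stays within a bounded
distance of `-tβ'`. So `γ(t) = g' exp(tη_t)K` with `η_t → β'`. By convexity along this segment, its
slope at a fixed time `r` is at most `Φ_x(γ(t))/t` up to `O(1/t)`; as `t → ∞`, the slope of `γ'` at
`r` is bounded by the asymptotic slope of `γ`. Exchanging the two geodesics gives equality. -/

noncomputable section

namespace KempfNess

/-! ### Comparison of logarithms of positive elements of a C⋆-algebra -/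

section CStar

variable {A : Type*} [CStarAlgebra A]

theorem norm_exp_le_exp_norm (a : A) : ‖NormedSpace.exp a‖ ≤ Real.exp ‖a‖ := by
  rcases subsingleton_or_nontrivial A with h | h
  · rw [Subsingleton.elim (NormedSpace.exp a) 0, norm_zero]
    positivity
  · let _ : NormedAlgebra ℚ A := NormedAlgebra.restrictScalars ℚ ℂ A
    rw [NormedSpace.exp_eq_tsum ℝ, Real.exp_eq_exp_ℝ, NormedSpace.exp_eq_tsum ℝ]
    refine tsum_of_norm_bounded (NormedSpace.expSeries_summable' (𝕂 := ℝ) ‖a‖).hasSum fun n => ?_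
    rw [norm_smul, smul_eq_mul, Real.norm_of_nonneg (by positivity)]
    gcongr
    exact norm_pow_le a n

variable [PartialOrder A] [StarOrderedRing A]

/-- Squaring removes the isometry `k`: `exp(2a) = exp(b) w*w exp(b) ≤ exp(2(b + c))`, and the
logarithm is operator monotone. -/
theorem le_add_of_exp_eq {a b k w : A} {c : ℝ} (ha : IsSelfAdjoint a) (hb : IsSelfAdjoint b)
    (hk : star k * k = 1) (h : NormedSpace.exp a = k * w * NormedSpace.exp b)
    (hw : ‖w‖ ≤ Real.exp c) : a ≤ b + algebraMap ℝ A c := by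
  let _ : NormedAlgebra ℚ A := NormedAlgebra.restrictScalars ℚ ℂ A
  have hexp : ∀ x : A, NormedSpace.exp ((2 : ℝ) • x) = NormedSpace.exp x * NormedSpace.exp x :=
    fun x => by rw [two_smul, NormedSpace.exp_add_of_commute (Commute.refl x)]
  have hsa : star (NormedSpace.exp a) = NormedSpace.exp a := ha.exp.star_eq
  have hsb : star (NormedSpace.exp b) = NormedSpace.exp b := hb.exp.star_eq
  have e1 : NormedSpace.exp ((2 : ℝ) • a)
      = star (NormedSpace.exp b) * (star w * w) * NormedSpace.exp b := by
    calc NormedSpace.exp ((2 : ℝ) • a) = star (NormedSpace.exp a) * NormedSpace.exp a := by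
          rw [hsa, hexp]
      _ = star (NormedSpace.exp b) * star w * (star k * k) * w * NormedSpace.exp b := by
          rw [h]; simp only [star_mul, mul_assoc]
      _ = _ := by rw [hk]; simp only [mul_one, mul_assoc]
  have e2 : NormedSpace.exp ((2 : ℝ) • a)
      ≤ NormedSpace.exp ((2 : ℝ) • (b + algebraMap ℝ A c)) := by
    have h1 : star w * w ≤ algebraMap ℝ A (Real.exp c ^ 2) :=
      CStarAlgebra.star_mul_le_algebraMap_norm_sq.trans
        (algebraMap_mono A (pow_le_pow_left₀ (norm_nonneg _) hw 2))
    rw [e1]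
    refine (star_left_conjugate_le_conjugate h1 _).trans (le_of_eq ?_)
    have h2 : (2 : ℝ) • (b + algebraMap ℝ A c) = algebraMap ℝ A (2 * c) + (2 : ℝ) • b := by
      rw [smul_add, add_comm, Algebra.algebraMap_eq_smul_one, Algebra.algebraMap_eq_smul_one,
        smul_smul]
    have h3 : Real.exp c ^ 2 = Real.exp (2 * c) := by
      rw [← Real.exp_nat_mul]; norm_num
    rw [h2, NormedSpace.exp_add_of_commute (Algebra.commutes _ _), hexp, hsb, h3,
      Real.exp_eq_exp_ℝ, NormedSpace.algebraMap_exp_comm]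
    rw [← NormedSpace.algebraMap_exp_comm, ← mul_assoc, Algebra.commutes (R := ℝ) (A := A)]
  have h2a : ∀ {x : A}, IsSelfAdjoint x → IsSelfAdjoint ((2 : ℝ) • x) := fun hx =>
    (IsSelfAdjoint.all (2 : ℝ)).smul hx
  have hpos : IsStrictlyPositive (NormedSpace.exp ((2 : ℝ) • a)) :=
    (NormedSpace.isUnit_exp _).isStrictlyPositive (h2a ha).exp_nonneg
  have hc : IsSelfAdjoint (algebraMap ℝ A c) := by
    rw [Algebra.algebraMap_eq_smul_one]
    exact (IsSelfAdjoint.all c).smul (IsSelfAdjoint.one A)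
  have := CFC.log_le_log e2 hpos
  rw [CFC.log_exp _ (h2a ha), CFC.log_exp _ (h2a (hb.add hc))] at this
  have h4 := smul_le_smul_of_nonneg_left this (show (0 : ℝ) ≤ 1 / 2 by norm_num)
  simpa [smul_smul] using h4

/-- The one-sided comparison applies to `a, b` with `w` and, after inverting and taking adjoints, to
`-a, -b` with `star w'`. -/
theorem norm_sub_le_of_exp_eq {a b k w w' : A} {c : ℝ} (hc : 0 ≤ c) (ha : IsSelfAdjoint a)
    (hb : IsSelfAdjoint b) (hk : star k * k = 1) (hw : w' * w = 1)
    (h : NormedSpace.exp a = k * w * NormedSpace.exp b)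
    (h1 : ‖w‖ ≤ Real.exp c) (h2 : ‖w'‖ ≤ Real.exp c) : ‖a - b‖ ≤ 3 * c := by
  let _ : NormedAlgebra ℚ A := NormedAlgebra.restrictScalars ℚ ℂ A
  have hinv : ∀ x : A, NormedSpace.exp x * NormedSpace.exp (-x) = 1 := fun x => by
    rw [← NormedSpace.exp_add_of_commute (Commute.neg_right (Commute.refl x))]; simp
  have hinv' : ∀ x : A, NormedSpace.exp (-x) * NormedSpace.exp x = 1 := fun x => by
    rw [← NormedSpace.exp_add_of_commute (Commute.neg_left (Commute.refl x))]; simp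
  have hI : NormedSpace.exp (-a) = NormedSpace.exp (-b) * w' * star k := by
    have : NormedSpace.exp (-b) * w' * star k * NormedSpace.exp a = 1 := by
      calc NormedSpace.exp (-b) * w' * star k * NormedSpace.exp a
          = NormedSpace.exp (-b) * (w' * (star k * k) * w) * NormedSpace.exp b := by
            rw [h]; simp only [mul_assoc]
        _ = 1 := by rw [hk, mul_one, hw, mul_one, hinv']
    calc NormedSpace.exp (-a)
        = (NormedSpace.exp (-b) * w' * star k * NormedSpace.exp a) * NormedSpace.exp (-a) := by
          rw [this, one_mul]
      _ = _ := by rw [mul_assoc _ (NormedSpace.exp a), hinv, mul_one]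
  have hJ : NormedSpace.exp (-a) = k * star w' * NormedSpace.exp (-b) := by
    have := congrArg star hI
    rwa [ha.neg.exp.star_eq, star_mul, star_mul, star_star, hb.neg.exp.star_eq, ← mul_assoc]
      at this
  have l1 := le_add_of_exp_eq ha hb hk h h1
  have l2 := le_add_of_exp_eq ha.neg hb.neg hk hJ (by rwa [norm_star])
  -- The norm criterion used is for positive elements, so `a - b` is shifted by `c`. The shifted
  -- element has norm at most `2c`, and undoing the shift costs another `c`; hence the constant 3.
  have n0 : 0 ≤ a - b + algebraMap ℝ A c := by
    have := neg_le_neg l2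
    rw [neg_neg, neg_add, neg_neg] at this
    have h3 := sub_nonneg.2 this
    have e : a - (b + -algebraMap ℝ A c) = a - b + algebraMap ℝ A c := by abel
    rwa [e] at h3
  have n1 : a - b + algebraMap ℝ A c ≤ algebraMap ℝ A (2 * c) := by
    rw [two_mul, map_add]
    gcongr
    exact sub_le_iff_le_add'.2 l1
  have n2 := (CStarAlgebra.norm_le_iff_le_algebraMap _ (by positivity : 0 ≤ 2 * c) n0).2 n1
  have n3 : ‖algebraMap ℝ A c‖ ≤ c := by
    rcases subsingleton_or_nontrivial A with h | h
    · rw [Subsingleton.elim (algebraMap ℝ A c) 0, norm_zero]; exact hc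
    · rw [norm_algebraMap', Real.norm_of_nonneg hc]
  calc ‖a - b‖ = ‖a - b + algebraMap ℝ A c - algebraMap ℝ A c‖ := by rw [add_sub_cancel_right]
    _ ≤ _ := (norm_sub_le _ _).trans (by linarith)

end CStar

/-! ### Real analysis -/

theorem hasFDerivAt_intervalIntegral_of_contDiff {W : Type*} [NormedAddCommGroup W]
    [NormedSpace ℝ W] [FiniteDimensional ℝ W] {f : W × ℝ → ℝ} (hf : ContDiff ℝ 1 f) (w : W) :
    HasFDerivAt (fun w => ∫ t in (0 : ℝ)..1, f (w, t))
      (∫ t in (0 : ℝ)..1, (fderiv ℝ f (w, t)).comp (ContinuousLinearMap.inl ℝ W ℝ)) w := by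
  have : ProperSpace W := FiniteDimensional.proper ℝ W
  have hc : Continuous fun q : W × ℝ =>
      (fderiv ℝ f q).comp (ContinuousLinearMap.inl ℝ W ℝ) :=
    (hf.continuous_fderiv one_ne_zero).clm_comp continuous_const
  obtain ⟨C, hC⟩ := ((isCompact_closedBall w 1).prod (isCompact_Icc (a := (0 : ℝ)) (b := 1))
    ).exists_bound_of_continuousOn hc.continuousOn
  refine intervalIntegral.hasFDerivAt_integral_of_dominated_of_fderiv_le (s := Metric.ball w 1)
    (bound := fun _ => C)
    (F' := fun w t => (fderiv ℝ f (w, t)).comp (ContinuousLinearMap.inl ℝ W ℝ))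
    (Metric.ball_mem_nhds w one_pos) ?_ ?_ ?_ ?_ ?_ ?_
  · refine Eventually.of_forall fun y => ?_
    exact (hf.continuous.comp (by fun_prop : Continuous fun t : ℝ => (y, t))).aestronglyMeasurable
  · exact (hf.continuous.comp
      (by fun_prop : Continuous fun t : ℝ => (w, t))).intervalIntegrable _ _
  · exact (hc.comp (by fun_prop : Continuous fun t : ℝ => (w, t))).aestronglyMeasurable
  · refine Eventually.of_forall fun t ht y hy => hC (y, t) ⟨Metric.ball_subset_closedBall hy, ?_⟩
    rw [uIoc_of_le zero_le_one] at ht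
    exact ⟨ht.1.le, ht.2⟩
  · exact intervalIntegrable_const
  · refine Eventually.of_forall fun t _ y _ => ?_
    have h1 := (hf.differentiable one_ne_zero (y, t)).hasFDerivAt
    exact h1.comp y (hasFDerivAt_prodMk_left y t)

/-- Grönwall's inequality with a variable rate. The comparison principle needs a strict inequality
of derivatives, so both the initial value and the rate are enlarged by `ε`, which then tends to `0`.
-/
theorem norm_le_mul_exp_integral {F : Type*} [NormedAddCommGroup F] [NormedSpace ℝ F]
    {f f' : ℝ → F} {n : ℝ → ℝ} (hf : ∀ t, HasDerivAt f (f' t) t) (hn : Continuous n)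
    (h : ∀ t, ‖f' t‖ ≤ ‖f t‖ * n t) :
    ‖f 1‖ ≤ ‖f 0‖ * Real.exp (∫ t in (0 : ℝ)..1, n t) := by
  have key : ∀ ε : ℝ, 0 < ε →
      ‖f 1‖ ≤ (‖f 0‖ + ε) * Real.exp ((∫ t in (0 : ℝ)..1, n t) + ε * 1) := by
    intro ε hε
    set N : ℝ → ℝ := fun x => (∫ t in (0 : ℝ)..x, n t) + ε * x with hN
    have hN' : ∀ x, HasDerivAt N (n x + ε) x := fun x => by
      have h1 := intervalIntegral.integral_hasDerivAt_right (hn.intervalIntegrable 0 x)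
        (hn.stronglyMeasurableAtFilter _ _) hn.continuousAt
      have h2 := (hasDerivAt_id x).const_mul ε
      rw [mul_one] at h2
      exact h1.add h2
    have hB : ∀ x, HasDerivAt (fun x => (‖f 0‖ + ε) * Real.exp (N x))
        ((‖f 0‖ + ε) * (Real.exp (N x) * (n x + ε))) x := fun x => (hN' x).exp.const_mul _
    refine image_norm_le_of_norm_deriv_right_lt_deriv_boundary' (a := 0) (b := 1)
      (fun x _ => (hf x).continuousAt.continuousWithinAt)
      (fun x _ => (hf x).hasDerivWithinAt)
      (B := fun x => (‖f 0‖ + ε) * Real.exp (N x)) ?_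
      (fun x _ => (hB x).continuousAt.continuousWithinAt)
      (fun x _ => (hB x).hasDerivWithinAt) ?_ (right_mem_Icc.2 zero_le_one)
    · simp [hN, hε.le]
    · intro x _ hx
      refine (h x).trans_lt ?_
      have hp : 0 < (‖f 0‖ + ε) * Real.exp (N x) := by positivity
      rw [hx, ← mul_assoc]
      exact mul_lt_mul_of_pos_left (by linarith) hp
  have hl : Tendsto (fun ε : ℝ => (‖f 0‖ + ε) * Real.exp ((∫ t in (0 : ℝ)..1, n t) + ε * 1))
      (𝓝[>] 0) (𝓝 ((‖f 0‖ + 0) * Real.exp ((∫ t in (0 : ℝ)..1, n t) + 0 * 1))) := by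
    refine Tendsto.mono_left (Continuous.tendsto ?_ 0) nhdsWithin_le_nhds
    fun_prop
  have := ge_of_tendsto hl (by filter_upwards [self_mem_nhdsWithin] with ε hε using key ε hε)
  simpa using this

theorem sub_bounds_of_monotone_deriv {f d : ℝ → ℝ} (hf : ∀ t, HasDerivAt f (d t) t)
    (hd : Monotone d) {a b : ℝ} (hab : a ≤ b) :
    d a * (b - a) ≤ f b - f a ∧ f b - f a ≤ d b * (b - a) := by
  have hdc : Differentiable ℝ f := fun t => (hf t).differentiableAt
  rcases hab.eq_or_lt with rfl | hab
  · simp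
  obtain ⟨c, hc, hc'⟩ := exists_hasDerivAt_eq_slope f d hab hdc.continuous.continuousOn
    (fun x _ => hf x)
  have hpos : 0 < b - a := sub_pos.2 hab
  rw [eq_div_iff hpos.ne'] at hc'
  rw [← hc']
  exact ⟨mul_le_mul_of_nonneg_right (hd hc.1.le) hpos.le,
    mul_le_mul_of_nonneg_right (hd hc.2.le) hpos.le⟩

/-- The asymptotic slope of a function with monotone derivative. -/
theorem tendsto_slope_of_monotone_deriv {f d : ℝ → ℝ} (hf : ∀ t, HasDerivAt f (d t) t)
    (hd : Monotone d) :
    Tendsto (fun t => (d t : EReal)) atTop (𝓝 (⨆ t, (d t : EReal))) ∧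
    Tendsto (fun t => ((f t / t : ℝ) : EReal)) atTop (𝓝 (⨆ t, (d t : EReal))) := by
  have hm : Monotone fun t => (d t : EReal) := fun a b h => EReal.coe_le_coe_iff.2 (hd h)
  have hdl := tendsto_atTop_iSup hm
  refine ⟨hdl, ?_⟩
  have mvt := fun a b => sub_bounds_of_monotone_deriv hf hd (a := a) (b := b)
  have inv0 : ∀ c : ℝ, Tendsto (fun t : ℝ => c / t) atTop (𝓝 0) := fun c =>
    tendsto_const_nhds.div_atTop tendsto_id
  refine tendsto_order.2 ⟨fun l hl => ?_, fun u hu => ?_⟩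
  · obtain ⟨s, hs⟩ := lt_iSup_iff.1 hl
    -- The tangent bound `f t ≥ f s + d s * (t - s)`, divided by `t`.
    have h1 : Tendsto (fun t : ℝ => d s + (f s - d s * s) / t) atTop (𝓝 (d s)) := by
      simpa using (inv0 (f s - d s * s)).const_add (d s)
    have h2 : Tendsto (fun t : ℝ => ((d s + (f s - d s * s) / t : ℝ) : EReal)) atTop
        (𝓝 (d s : EReal)) := (continuous_coe_real_ereal.tendsto _).comp h1
    filter_upwards [h2.eventually (lt_mem_nhds hs), eventually_ge_atTop s,
      eventually_gt_atTop 0] with t ht hst h0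
    refine ht.trans_le (EReal.coe_le_coe_iff.2 ?_)
    rw [le_div_iff₀ h0, add_mul, div_mul_cancel₀ _ h0.ne']
    linarith [(mvt s t hst).1]
  · have hle : ∀ t : ℝ, (d t : EReal) ≤ ⨆ t, (d t : EReal) := fun t =>
      le_iSup (fun t => (d t : EReal)) t
    -- An upper bound is only at stake when the supremum is finite; then `f t ≤ f 0 + L * t`.
    obtain ⟨L, hL⟩ : ∃ L : ℝ, (⨆ t, (d t : EReal)) = L := by
      refine ⟨_, (EReal.coe_toReal hu.ne_top ?_).symm⟩
      exact ((EReal.bot_lt_coe (d 0)).trans_le (hle 0)).ne'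
    have h1 : Tendsto (fun t : ℝ => f 0 / t + L) atTop (𝓝 L) := by
      simpa using (inv0 (f 0)).add_const L
    have h2 : Tendsto (fun t : ℝ => ((f 0 / t + L : ℝ) : EReal)) atTop (𝓝 (L : EReal)) :=
      (continuous_coe_real_ereal.tendsto _).comp h1
    rw [hL] at hu
    filter_upwards [h2.eventually (gt_mem_nhds hu), eventually_gt_atTop 0] with t ht h0
    refine lt_of_le_of_lt (EReal.coe_le_coe_iff.2 ?_) ht
    have h3 : d t ≤ L := by
      have := hle t
      rw [hL] at this
      exact EReal.coe_le_coe_iff.1 this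
    rw [div_add' _ _ _ h0.ne']
    gcongr
    nlinarith [(mvt 0 t h0.le).2]

/-! ### The Lie algebra of the compact group -/

section Lie

variable {V : Type*} [NormedAddCommGroup V] [InnerProductSpace ℂ V] [FiniteDimensional ℂ V]

theorem coe_expU (A : V →L[ℂ] V) : (expU A : V →L[ℂ] V) = NormedSpace.exp A := rfl

theorem coe_expU_inv (A : V →L[ℂ] V) :
    (((expU A)⁻¹ : (V →L[ℂ] V)ˣ) : V →L[ℂ] V) = NormedSpace.exp (-A) := rfl

theorem expU_conj (g : (V →L[ℂ] V)ˣ) (A : V →L[ℂ] V) :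
    expU ((g : V →L[ℂ] V) * A * ((g⁻¹ : (V →L[ℂ] V)ˣ) : V →L[ℂ] V)) = g * expU A * g⁻¹ := by
  have : CompleteSpace V := FiniteDimensional.complete ℂ V
  let _ : NormedAlgebra ℚ (V →L[ℂ] V) := NormedAlgebra.restrictScalars ℚ ℂ _
  apply Units.ext
  exact NormedSpace.exp_units_conj g A

theorem hasDerivAt_exp_smul (A : V →L[ℂ] V) (t : ℝ) :
    HasDerivAt (fun s : ℝ => NormedSpace.exp (s • A)) (A * NormedSpace.exp (t • A)) t := by
  have : CompleteSpace V := FiniteDimensional.complete ℂ V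
  exact hasDerivAt_exp_smul_const' A t

theorem hasDerivAt_exp_smul' (A : V →L[ℂ] V) (t : ℝ) :
    HasDerivAt (fun s : ℝ => NormedSpace.exp (s • A)) (NormedSpace.exp (t • A) * A) t := by
  have : CompleteSpace V := FiniteDimensional.complete ℂ V
  exact hasDerivAt_exp_smul_const A t

theorem contDiff_exp_End {n : ℕ∞ω} :
    ContDiff ℝ n (NormedSpace.exp : (V →L[ℂ] V) → (V →L[ℂ] V)) := by
  have : CompleteSpace V := FiniteDimensional.complete ℂ V
  exact contDiff_iff_contDiffAt.2 fun x => (NormedSpace.exp_analytic (𝕂 := ℝ) x).contDiffAt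

namespace CompatibleGroup

variable (S : CompatibleGroup V)

/-- An element of `U^ℂ` as an endomorphism of `V`. -/
abbrev toEnd (g : S.UC) : V →L[ℂ] V := ((g : (V →L[ℂ] V)ˣ) : V →L[ℂ] V)

theorem toEnd_one : S.toEnd 1 = 1 := rfl

theorem conj_mem_u {g : (V →L[ℂ] V)ˣ} (hg : g ∈ S.U) {ξ : V →L[ℂ] V} (hξ : ξ ∈ S.u) :
    (g : V →L[ℂ] V) * ξ * ((g⁻¹ : (V →L[ℂ] V)ˣ) : V →L[ℂ] V) ∈ S.u := by
  intro t
  rw [← smul_mul_assoc, ← mul_smul_comm, expU_conj]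
  exact S.U.mul_mem (S.U.mul_mem hg (hξ t)) (S.U.inv_mem hg)

theorem exists_leftInverse_u : ∃ f : (V →L[ℂ] V) →ₗ[ℝ] S.u, ∀ ξ : S.u, f ξ = ξ := by
  obtain ⟨f, hf⟩ := LinearMap.exists_leftInverse_of_injective S.u.subtype (Submodule.ker_subtype _)
  exact ⟨f, LinearMap.congr_fun hf⟩

variable [CompleteSpace V]

theorem star_mul_self_of_mem_U {g : (V →L[ℂ] V)ˣ} (hg : g ∈ S.U) :
    star (g : V →L[ℂ] V) * (g : V →L[ℂ] V) = 1 :=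
  (ContinuousLinearMap.norm_map_iff_adjoint_comp_self _).1 (S.unitary_U g hg)

theorem star_eq_neg_of_mem_u {ξ : V →L[ℂ] V} (hξ : ξ ∈ S.u) : star ξ = -ξ := by
  have h1 : ∀ t : ℝ, star (NormedSpace.exp (t • ξ)) * NormedSpace.exp (t • ξ) = 1 :=
    fun t => S.star_mul_self_of_mem_U (g := expU (t • ξ)) (hξ t)
  have h0 : HasDerivAt (fun t : ℝ => NormedSpace.exp (t • ξ)) ξ 0 := by
    simpa using hasDerivAt_exp_smul ξ 0
  have h2 : HasDerivAt
      (fun t : ℝ => star (NormedSpace.exp (t • ξ)) * NormedSpace.exp (t • ξ)) (star ξ + ξ) 0 := by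
    refine (h0.star.mul h0).congr_deriv ?_
    simp
  have h3 : HasDerivAt (fun t : ℝ => star (NormedSpace.exp (t • ξ)) * NormedSpace.exp (t • ξ))
      0 0 := by
    simp only [h1]
    exact hasDerivAt_const _ _
  exact eq_neg_of_add_eq_zero_left (h2.unique h3)

/-- A linear projection of `𝔤𝔩(V)` onto `𝔲` which vanishes on the self-adjoint operators. -/
def skewProj : (V →L[ℂ] V) →ₗ[ℝ] S.u :=
  S.exists_leftInverse_u.choose ∘ₗ
    ((1 / 2 : ℝ) • (LinearMap.id - (starLinearEquiv ℝ (A := V →L[ℂ] V)).toLinearMap))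

theorem skewProj_apply (A : V →L[ℂ] V) :
    S.skewProj A = S.exists_leftInverse_u.choose ((1 / 2 : ℝ) • (A - star A)) := rfl

theorem skewProj_coe (ξ : S.u) : S.skewProj (ξ : V →L[ℂ] V) = ξ := by
  rw [skewProj_apply, S.star_eq_neg_of_mem_u ξ.2, sub_neg_eq_add, ← two_smul ℝ, smul_smul]
  rw [show (1 / 2 : ℝ) * 2 = 1 by norm_num, one_smul, S.exists_leftInverse_u.choose_spec ξ]

theorem skewProj_of_isSelfAdjoint {A : V →L[ℂ] V} (hA : IsSelfAdjoint A) : S.skewProj A = 0 := by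
  rw [skewProj_apply, hA.star_eq, sub_self, smul_zero, map_zero]

end CompatibleGroup

end Lie

/-! ### Orbit maps -/

/-- The point is that the real derivative is complex linear: for orbit maps this turns the direction
`iη` into `J` applied to the fundamental field of `η`. -/
theorem hasMFDerivAt_real_of_contMDiffAt_complex {F E Z : Type*} [NormedAddCommGroup F]
    [NormedSpace ℂ F] [NormedAddCommGroup E] [NormedSpace ℂ E] [TopologicalSpace Z]
    [ChartedSpace E Z] {O : F → Z} {a : F} (h : ContMDiffAt 𝓘(ℂ, F) 𝓘(ℂ, E) ω O a) :
    ContMDiffAt 𝓘(ℝ, F) 𝓘(ℝ, E) ω O a ∧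
    ∃ D : F →L[ℂ] E, HasMFDerivAt 𝓘(ℝ, F) 𝓘(ℝ, E) O a (D.restrictScalars ℝ : F →L[ℝ] E) := by
  have h1 := contMDiffAt_iff.1 h
  refine ⟨contMDiffAt_iff.2 ⟨h1.1, h1.2.restrict_scalars ℝ⟩, ?_⟩
  have h2 := (h1.2.differentiableWithinAt (by simp)).hasFDerivWithinAt
  refine ⟨_, h1.1, h2.restrictScalars ℝ⟩

section Orbit

variable {V : Type*} [NormedAddCommGroup V] [InnerProductSpace ℂ V] [FiniteDimensional ℂ V]
  {S : CompatibleGroup V} {E Z : Type*} [NormedAddCommGroup E] [NormedSpace ℂ E]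
  [TopologicalSpace Z] [ChartedSpace E Z] [MulAction S.UC Z]

/-- Extending `g ↦ g • x` to a map near `g₀` in `𝔤𝔩(V)` allows calculus in a vector space, with no
manifold structure on `U^ℂ`. -/
theorem IsHolomorphicAction.exists_orbitMap (h : IsHolomorphicAction E (Z := Z) S.UC) (g₀ : S.UC)
    (x : Z) : ∃ O : (V →L[ℂ] V) → Z, ContMDiffAt 𝓘(ℂ, V →L[ℂ] V) 𝓘(ℂ, E) ω O (S.toEnd g₀) ∧
      ∀ᶠ A in 𝓝 (S.toEnd g₀), ∀ g : S.UC, S.toEnd g = A → O A = g • x := by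
  obtain ⟨Ψ, hΨ, hΨ'⟩ := h g₀ x
  refine ⟨fun A => Ψ (A, x), ?_, ?_⟩
  · exact hΨ.comp (S.toEnd g₀) (contMDiffAt_id.prodMk contMDiffAt_const)
  · exact (Continuous.tendsto (by fun_prop : Continuous fun A : V →L[ℂ] V => (A, x))
      (S.toEnd g₀)).eventually hΨ'

/-- Since `c(t)x = (c(t)c(t₀)⁻¹)z`, every curve can be translated to pass through `1`. One `D`,
depending only on `z`, therefore serves all curves, and can be compared between them. -/
theorem IsHolomorphicAction.exists_orbitDeriv (h : IsHolomorphicAction E (Z := Z) S.UC) (z : Z) :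
    ∃ D : (V →L[ℂ] V) →L[ℂ] E, ∀ (c : ℝ → S.UC) (t₀ : ℝ) (c' : V →L[ℂ] V) (x : Z),
      HasDerivAt (fun t => S.toEnd (c t)) c' t₀ → c t₀ • x = z →
      HasMFDerivAt 𝓘(ℝ, ℝ) 𝓘(ℝ, E) (fun t => c t • x) t₀
        (ContinuousLinearMap.toSpanSingleton ℝ (D (c' * S.toEnd (c t₀)⁻¹)) : ℝ →L[ℝ] E) := by
  obtain ⟨O, hO, hO'⟩ := h.exists_orbitMap 1 z
  obtain ⟨D, hD⟩ := (hasMFDerivAt_real_of_contMDiffAt_complex hO).2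
  refine ⟨D, fun c t₀ c' x hc hx => ?_⟩
  have h1 : HasDerivAt (fun t => S.toEnd (c t * (c t₀)⁻¹)) (c' * S.toEnd (c t₀)⁻¹) t₀ :=
    hc.mul_const _
  have e1 : S.toEnd (c t₀ * (c t₀)⁻¹) = S.toEnd 1 := by rw [mul_inv_cancel]
  have h2 := h1.continuousAt.tendsto
  rw [e1] at h2
  have h3 : (fun t => c t • x) =ᶠ[𝓝 t₀] fun t => O (S.toEnd (c t * (c t₀)⁻¹)) := by
    filter_upwards [h2.eventually hO'] with t ht
    rw [ht _ rfl, ← hx, smul_smul, mul_assoc, inv_mul_cancel, mul_one]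
  rw [← e1] at hD
  have h4 := HasMFDerivAt.comp t₀ hD h1.hasFDerivAt.hasMFDerivAt
  refine (h4.congr_of_eventuallyEq h3).congr_mfderiv ?_
  refine ContinuousLinearMap.ext_ring ?_
  change D ((1 : ℝ) • (c' * S.toEnd (c t₀)⁻¹)) = (1 : ℝ) • D (c' * S.toEnd (c t₀)⁻¹)
  rw [one_smul, one_smul]

end Orbit

/-! ### Derivatives of the momentum map along curves in `U^ℂ`. -/

namespace HamiltonianKahler

variable {V : Type*} [NormedAddCommGroup V] [InnerProductSpace ℂ V] [FiniteDimensional ℂ V]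
  {S : CompatibleGroup V} {E Z : Type*} [NormedAddCommGroup E] [NormedSpace ℂ E]
  [TopologicalSpace Z] [ChartedSpace E Z] [IsManifold 𝓘(ℂ, E) ω Z] [MulAction S.UC Z]
  (H : HamiltonianKahler S E Z)

theorem contDiff_moment_comp {W : Type*} [NormedAddCommGroup W] [NormedSpace ℝ W] {c : W → S.UC}
    (hc : ContDiff ℝ ∞ fun w => S.toEnd (c w)) (x : Z) (ζ : S.u) :
    ContDiff ℝ ∞ fun w => H.μ (c w • x) ζ := by
  refine contDiff_iff_contDiffAt.2 fun w => ?_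
  obtain ⟨O, hO, hO'⟩ := H.holomorphic.exists_orbitMap (c w) x
  have h1 : ContMDiffAt 𝓘(ℝ, V →L[ℂ] V) 𝓘(ℝ, E) ∞ O (S.toEnd (c w)) :=
    (hasMFDerivAt_real_of_contMDiffAt_complex hO).1.of_le (by simp)
  have h2 : ContMDiffAt 𝓘(ℝ, W) 𝓘(ℝ, ℝ) ∞ (fun w => H.μ (O (S.toEnd (c w))) ζ) w :=
    (H.contMDiff_μ ζ _).comp w (h1.comp w hc.contDiffAt.contMDiffAt)
  refine h2.contDiffAt.congr_of_eventuallyEq ?_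
  filter_upwards [(hc.continuous.tendsto w).eventually hO'] with y hy
  rw [hy _ rfl]

/-- The metric `h` on fundamental vector fields of `𝔲`. -/
def fundInner (z : Z) (ζ η : S.u) : ℝ :=
  H.h.inner z (fundVF E S.UC ζ (S.exp_mem_of_u ζ) z) (fundVF E S.UC η (S.exp_mem_of_u η) z)

theorem fundInner_comm (z : Z) (ζ η : S.u) : H.fundInner z ζ η = H.fundInner z η ζ :=
  H.h.symm z _ _

theorem fundInner_self_nonneg (z : Z) (ζ : S.u) : 0 ≤ H.fundInner z ζ ζ := by
  unfold fundInner
  by_cases h : fundVF E S.UC ζ (S.exp_mem_of_u ζ) z = 0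
  · rw [h]; simp
  · exact (H.h.pos z _ h).le

/-- By equivariance `μ(exp(tX)z)(ζ) = μ(z)(Ad(exp(-tX))ζ)`. The map `skewProj` extends the form `μ
z` linearly to `𝔤𝔩(V)`, so that the right side can be differentiated there. -/
theorem hasDerivAt_moment_exp [CompleteSpace V] (z : Z) (X ζ : S.u) :
    HasDerivAt (fun t : ℝ => H.μ ((⟨expU (t • (X : V →L[ℂ] V)), S.exp_mem_of_u X t⟩ : S.UC) • z) ζ)
      (H.μ z (S.skewProj ((ζ : V →L[ℂ] V) * X - X * ζ))) 0 := by
  have e : ∀ t : ℝ,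
      H.μ ((⟨expU (t • (X : V →L[ℂ] V)), S.exp_mem_of_u X t⟩ : S.UC) • z) ζ =
      H.μ z (S.skewProj (NormedSpace.exp (t • (-(X : V →L[ℂ] V))) * ζ *
        NormedSpace.exp (t • (X : V →L[ℂ] V)))) := by
    intro t
    have hU : expU (t • (X : V →L[ℂ] V)) ∈ S.U := X.2 t
    have hm := S.conj_mem_u (S.U.inv_mem hU) ζ.2
    have h1 := H.equivariant ⟨expU (t • (X : V →L[ℂ] V)), S.exp_mem_of_u X t⟩ hU z ⟨_, hm⟩ ζ (by
      simp only [inv_inv]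
      rw [← mul_assoc, ← mul_assoc, Units.mul_inv, one_mul, mul_assoc, Units.mul_inv, mul_one])
    rw [h1, ← S.skewProj_coe ⟨_, hm⟩]
    simp only [inv_inv, coe_expU_inv, coe_expU, smul_neg]
  simp only [e]
  have h1 := ((hasDerivAt_exp_smul (-(X : V →L[ℂ] V)) 0).mul_const (ζ : V →L[ℂ] V)).mul
    (hasDerivAt_exp_smul (X : V →L[ℂ] V) 0)
  simp only [zero_smul, NormedSpace.exp_zero, mul_one, one_mul] at h1
  have h2 := ((H.μ z ∘ₗ S.skewProj).toContinuousLinearMap.hasFDerivAt).comp_hasDerivAt 0 h1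
  refine h2.congr_deriv ?_
  change H.μ z (S.skewProj _) = _
  congr 2
  rw [neg_mul]; abel

theorem expG_zero_smul (X : S.u) :
    (⟨expU ((0 : ℝ) • (X : V →L[ℂ] V)), S.exp_mem_of_u X 0⟩ : S.UC) = 1 := by
  ext1
  apply Units.ext
  simp [coe_expU]

theorem hasDerivAt_toEnd_exp (X : S.u) :
    HasDerivAt (fun t : ℝ => S.toEnd ⟨expU (t • (X : V →L[ℂ] V)), S.exp_mem_of_u X t⟩) X 0 := by
  have h := hasDerivAt_exp_smul (X : V →L[ℂ] V) 0
  rw [zero_smul, NormedSpace.exp_zero, mul_one] at h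
  exact h

theorem exists_momentDeriv (z : Z) : ∃ D : (V →L[ℂ] V) →L[ℂ] E,
    (∀ (c : ℝ → S.UC) (t₀ : ℝ) (c' : V →L[ℂ] V) (x : Z) (ζ : S.u),
      HasDerivAt (fun t => S.toEnd (c t)) c' t₀ → c t₀ • x = z →
      HasDerivAt (fun t => H.μ (c t • x) ζ)
        (form H.h z (fundVF E S.UC ζ (S.exp_mem_of_u ζ) z) (D (c' * S.toEnd (c t₀)⁻¹) : E)) t₀) ∧
    ∀ ξ : S.u, fundVF E S.UC ξ (S.exp_mem_of_u ξ) z = (D ξ : E) := by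
  obtain ⟨D, hD⟩ := H.holomorphic.exists_orbitDeriv z
  refine ⟨D, fun c t₀ c' x ζ hc hx => ?_, fun ξ => ?_⟩
  · have h1 := hD c t₀ c' x hc hx
    subst hx
    have h2 := ((H.contMDiff_μ ζ).mdifferentiable (by simp) (c t₀ • x)).hasMFDerivAt
    obtain ⟨A, hA⟩ : ∃ A : E →L[ℝ] ℝ,
        A = mfderiv 𝓘(ℝ, E) 𝓘(ℝ, ℝ) (fun y => H.μ y ζ) (c t₀ • x) := ⟨_, rfl⟩
    rw [← hA] at h2
    have h3 : HasFDerivAt (fun t => H.μ (c t • x) ζ)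
        (A.comp (ContinuousLinearMap.toSpanSingleton ℝ (D (c' * S.toEnd (c t₀)⁻¹)) : ℝ →L[ℝ] E)) t₀ :=
      hasMFDerivAt_iff_hasFDerivAt.1 (HasMFDerivAt.comp t₀ h2 h1)
    refine h3.hasDerivAt.congr_deriv ?_
    rw [ContinuousLinearMap.comp_apply, ContinuousLinearMap.toSpanSingleton_apply, one_smul, hA]
    exact H.moment ζ (c t₀ • x) _
  · have h1 := hD (fun t => ⟨expU (t • (ξ : V →L[ℂ] V)), S.exp_mem_of_u ξ t⟩) 0 ξ z
      (hasDerivAt_toEnd_exp ξ) (by rw [expG_zero_smul, one_smul])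
    unfold fundVF
    rw [h1.mfderiv, expG_zero_smul]
    change (1 : ℝ) • D ((ξ : V →L[ℂ] V) * S.toEnd (1 : S.UC)⁻¹) = D ξ
    rw [one_smul, inv_one, S.toEnd_one, mul_one]

/-- The basic formula for a curve with right logarithmic derivative `X + iη`. The `X` part is
equivariance; for the `iη` part, `ω(ζ_Z, Jη_Z) = h(Jζ_Z, Jη_Z) = h(ζ_Z, η_Z)`. -/
theorem hasDerivAt_moment_comp [CompleteSpace V] {c : ℝ → S.UC} {t₀ : ℝ} {c' : V →L[ℂ] V}
    (hc : HasDerivAt (fun t => S.toEnd (c t)) c' t₀) {X η : S.u}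
    (hX : c' * S.toEnd (c t₀)⁻¹ = X + Complex.I • (η : V →L[ℂ] V)) (x : Z) (ζ : S.u) :
    HasDerivAt (fun t => H.μ (c t • x) ζ)
      (H.μ (c t₀ • x) (S.skewProj ((ζ : V →L[ℂ] V) * X - X * ζ))
        + H.fundInner (c t₀ • x) ζ η) t₀ := by
  obtain ⟨D, hD, hfund⟩ := H.exists_momentDeriv (c t₀ • x)
  refine (hD c t₀ c' x ζ hc rfl).congr_deriv ?_
  have h2 := hD (fun t => ⟨expU (t • (X : V →L[ℂ] V)), S.exp_mem_of_u X t⟩) 0 X (c t₀ • x) ζ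
    (hasDerivAt_toEnd_exp X) (by rw [expG_zero_smul, one_smul])
  have h3 := h2.unique (H.hasDerivAt_moment_exp (c t₀ • x) X ζ)
  rw [expG_zero_smul, inv_one, S.toEnd_one, mul_one] at h3
  rw [hX, map_add, map_smul, ← h3]
  have h4 : H.fundInner (c t₀ • x) ζ η = form H.h (c t₀ • x)
      (fundVF E S.UC ζ (S.exp_mem_of_u ζ) (c t₀ • x)) (Complex.I • D η : E) := by
    unfold fundInner
    rw [← H.isKahler.hermitian, hfund η]
    rfl
  rw [h4]
  exact map_add (H.h.inner (c t₀ • x) (J (c t₀ • x) _)) _ _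

end HamiltonianKahler

/-! ### The differential of the exponential map and the complexified Lie algebra. -/

theorem exists_hasDerivAt_mixed {F : Type*} [NormedAddCommGroup F] [NormedSpace ℝ F]
    {f : ℝ × ℝ → F} (hf : ContDiff ℝ 2 f) (s t : ℝ) :
    ∃ m : F, HasDerivAt (fun t => fderiv ℝ f (s, t) (1, 0)) m t ∧
      HasDerivAt (fun s => fderiv ℝ f (s, t) (0, 1)) m s := by
  have hfd : ∀ q, HasFDerivAt f (fderiv ℝ f q) q := fun q =>
    (hf.differentiable two_ne_zero q).hasFDerivAt
  have hfd2 := ((hf.fderiv_right (m := 1) (by norm_num)).differentiable one_ne_zero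
    (s, t)).hasFDerivAt
  refine ⟨fderiv ℝ (fderiv ℝ f) (s, t) (0, 1) (1, 0), ?_, ?_⟩
  · have h := hfd2.comp_hasDerivAt (f := fun t => (s, t)) t
      ((hasDerivAt_const t s).prodMk (hasDerivAt_id' t))
    simpa using h.clm_apply (hasDerivAt_const t ((1, 0) : ℝ × ℝ))
  · rw [← second_derivative_symmetric hfd hfd2 (1, 0) (0, 1)]
    have h := hfd2.comp_hasDerivAt (f := fun s => (s, t)) s
      ((hasDerivAt_id' s).prodMk (hasDerivAt_const s t))
    simpa using h.clm_apply (hasDerivAt_const s ((0, 1) : ℝ × ℝ))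

section Lie

variable {V : Type*} [NormedAddCommGroup V] [InnerProductSpace ℂ V] [FiniteDimensional ℂ V]

theorem exp_mul_exp_neg (A : V →L[ℂ] V) : NormedSpace.exp A * NormedSpace.exp (-A) = 1 :=
  (expU A).mul_inv

theorem exp_neg_mul_exp (A : V →L[ℂ] V) : NormedSpace.exp (-A) * NormedSpace.exp A = 1 :=
  (expU A).inv_mul

/-- The derivative of `s ↦ exp (t (ξ + s δ))` at `s = 0`, as the solution of a linear
differential equation in `t`. -/
theorem exists_deriv_exp (ξ δ : V →L[ℂ] V) : ∃ D : ℝ → (V →L[ℂ] V), D 0 = 0 ∧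
    (∀ t, HasDerivAt D (δ * NormedSpace.exp (t • ξ) + ξ * D t) t) ∧
    ∀ t : ℝ, HasDerivAt (fun s : ℝ => NormedSpace.exp (t • (ξ + s • δ))) (D t) 0 := by
  set f : ℝ × ℝ → (V →L[ℂ] V) := fun q => NormedSpace.exp (q.2 • (ξ + q.1 • δ)) with hf
  have hfc : ContDiff ℝ 2 f := contDiff_exp_End.comp (by fun_prop)
  have hfd : ∀ q, HasFDerivAt f (fderiv ℝ f q) q := fun q =>
    (hfc.differentiable two_ne_zero q).hasFDerivAt
  have hs : ∀ s t : ℝ, HasDerivAt (fun s => f (s, t)) (fderiv ℝ f (s, t) (1, 0)) s := fun s t =>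
    (hfd (s, t)).comp_hasDerivAt (f := fun s => (s, t)) s ((hasDerivAt_id' s).prodMk (hasDerivAt_const s t))
  have ht : ∀ s t : ℝ, fderiv ℝ f (s, t) (0, 1) = (ξ + s • δ) * f (s, t) := fun s t =>
    ((hfd (s, t)).comp_hasDerivAt t ((hasDerivAt_const t s).prodMk (hasDerivAt_id' t))).unique
      (hasDerivAt_exp_smul (ξ + s • δ) t)
  refine ⟨fun t => fderiv ℝ f (0, t) (1, 0), ?_, fun t => ?_, fun t => hs 0 t⟩
  · refine (hs 0 0).unique ?_
    simp only [hf, zero_smul]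
    exact hasDerivAt_const _ _
  -- Symmetry of second derivatives: the equation in `t` is obtained by differentiating `∂f/∂t = (ξ
  -- + sδ) f` in `s`.
  · obtain ⟨m, h1, h2⟩ := exists_hasDerivAt_mixed hfc 0 t
    have h3 : HasDerivAt (fun s : ℝ => (ξ + s • δ) * f (s, t))
        (δ * f (0, t) + ξ * fderiv ℝ f (0, t) (1, 0)) 0 := by
      have h4 : HasDerivAt (fun s : ℝ => ξ + s • δ) δ 0 := by
        simpa using ((hasDerivAt_id (0 : ℝ)).smul_const δ).const_add ξ
      refine (h4.mul (hs 0 t)).congr_deriv ?_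
      simp
    simp only [ht] at h2
    refine h1.congr_deriv ?_
    rw [h2.unique h3]
    simp [hf]

namespace CompatibleGroup

variable (S : CompatibleGroup V)

/-- The complexification `𝔲 ⊕ i𝔲` of `𝔲`. -/
def uC : Submodule ℂ (V →L[ℂ] V) where
  carrier := {A | ∃ X η : S.u, A = X + Complex.I • (η : V →L[ℂ] V)}
  zero_mem' := ⟨0, 0, by simp⟩
  add_mem' := by
    rintro _ _ ⟨X, η, rfl⟩ ⟨X', η', rfl⟩
    refine ⟨X + X', η + η', ?_⟩
    simp only [Submodule.coe_add, smul_add]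
    abel
  smul_mem' := by
    rintro c _ ⟨X, η, rfl⟩
    refine ⟨c.re • X - c.im • η, c.im • X + c.re • η, ?_⟩
    simp only [Submodule.coe_add, Submodule.coe_sub, Submodule.coe_smul, ← Complex.coe_smul,
      smul_add, smul_smul]
    nth_rewrite 1 2 [← Complex.re_add_im c]
    have e : ((c.re : ℂ) + c.im * Complex.I) * Complex.I = -(c.im : ℂ) + Complex.I * c.re := by
      linear_combination (c.im : ℂ) * Complex.I_sq
    rw [e]
    module

theorem u_le_uC {X : V →L[ℂ] V} (hX : X ∈ S.u) : X ∈ S.uC := ⟨⟨X, hX⟩, 0, by simp⟩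

/-- A subspace is cut out by its annihilator. Membership thus becomes the vanishing of scalar
functions, open to the identity theorem and to constancy arguments. -/
theorem mem_uC_of_forall_dual {A : V →L[ℂ] V}
    (h : ∀ φ : (V →L[ℂ] V) →ₗ[ℂ] ℂ, (∀ B ∈ S.uC, φ B = 0) → φ A = 0) : A ∈ S.uC :=
  (Subspace.forall_mem_dualAnnihilator_apply_eq_zero_iff S.uC A).1 fun φ hφ =>
    h φ ((Submodule.mem_dualAnnihilator φ).1 hφ)

/-- For `φ` annihilating `𝔲 ⊕ i𝔲`, the function `c ↦ φ(exp(cX) A exp(-cX))` is entire. It vanishes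
for real `c` because `Ad(U)` preserves `𝔲`, hence for all complex `c`. -/
theorem conj_exp_mem_uC {X A : V →L[ℂ] V} (hX : X ∈ S.u) (hA : A ∈ S.uC) (c : ℂ) :
    NormedSpace.exp (c • X) * A * NormedSpace.exp (-(c • X)) ∈ S.uC := by
  have : CompleteSpace V := FiniteDimensional.complete ℂ V
  refine S.mem_uC_of_forall_dual fun φ hφ => ?_
  set f : ℂ → ℂ := fun c => φ (NormedSpace.exp (c • X) * A * NormedSpace.exp (c • (-X))) with hf
  have hd : Differentiable ℂ f := by
    intro c
    have h := ((hasDerivAt_exp_smul_const X c).mul_const A).mul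
      (hasDerivAt_exp_smul_const (-X) c)
    exact (φ.toContinuousLinearMap.hasFDerivAt.comp_hasDerivAt c h).differentiableAt
  have hr : ∀ t : ℝ, f t = 0 := by
    intro t
    obtain ⟨Y, η, rfl⟩ := hA
    have h1 : ∀ Y : S.u, NormedSpace.exp ((t : ℂ) • X) * (Y : V →L[ℂ] V) *
        NormedSpace.exp ((t : ℂ) • (-X)) ∈ S.u := by
      intro Y
      have := S.conj_mem_u (hX t) Y.2
      rwa [coe_expU, coe_expU_inv, ← smul_neg] at this
    refine hφ _ ?_
    rw [mul_add, add_mul, mul_smul_comm, smul_mul_assoc]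
    exact ⟨⟨_, h1 Y⟩, ⟨_, h1 η⟩, rfl⟩
  have hz : f = 0 := by
    have ha : AnalyticOnNhd ℂ f univ := fun z _ =>
      hd.analyticAt z
    refine AnalyticOnNhd.eq_of_frequently_eq (z₀ := 0) ha analyticOnNhd_const ?_
    have ht : Tendsto (fun t : ℝ => (t : ℂ)) (𝓝[≠] 0) (𝓝[≠] 0) := by
      refine tendsto_nhdsWithin_of_tendsto_nhds_of_eventually_within _ ?_ ?_
      · exact (Complex.continuous_ofReal.tendsto' 0 0 Complex.ofReal_zero).mono_left
          nhdsWithin_le_nhds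
      · filter_upwards [self_mem_nhdsWithin] with t ht
        simpa using ht
    exact ht.frequently (Eventually.of_forall fun t => hr t).frequently
  have := congrFun hz c
  simpa [hf, smul_neg] using this

/-- The subspace `i𝔲`. -/
def iu : Submodule ℝ (V →L[ℂ] V) :=
  S.u.comap (DistribSMul.toLinearMap ℝ (V →L[ℂ] V) (-Complex.I))

theorem p_le_iu : S.p ≤ S.iu := inf_le_right

theorem eq_I_smul_of_mem_iu {ξ : V →L[ℂ] V} (hξ : ξ ∈ S.iu) :
    ∃ ζ : S.u, (ζ : V →L[ℂ] V) = -Complex.I • ξ ∧ ξ = Complex.I • (ζ : V →L[ℂ] V) := by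
  refine ⟨⟨-Complex.I • ξ, hξ⟩, rfl, ?_⟩
  rw [smul_smul, mul_neg, Complex.I_mul_I, neg_neg, one_smul]

theorem iu_le_uC {ξ : V →L[ℂ] V} (hξ : ξ ∈ S.iu) : ξ ∈ S.uC := by
  obtain ⟨ζ, -, rfl⟩ := S.eq_I_smul_of_mem_iu hξ
  exact S.uC.smul_mem _ (S.u_le_uC ζ.2)

theorem exp_mem_of_iu {ξ : V →L[ℂ] V} (hξ : ξ ∈ S.iu) : expU ξ ∈ S.UC := by
  obtain ⟨ζ, -, rfl⟩ := S.eq_I_smul_of_mem_iu hξ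
  exact (S.mem_UC _).2 ⟨1, S.U.one_mem, ζ, ζ.2, (one_mul _).symm⟩

/-- The element `exp ξ` of `U^ℂ` for `ξ ∈ i𝔲`. -/
def expI (ξ : S.iu) : S.UC := ⟨expU (ξ : V →L[ℂ] V), S.exp_mem_of_iu ξ.2⟩

theorem conj_exp_iu_mem_uC {ξ A : V →L[ℂ] V} (hξ : ξ ∈ S.iu) (hA : A ∈ S.uC) (t : ℝ) :
    NormedSpace.exp (t • ξ) * A * NormedSpace.exp (-(t • ξ)) ∈ S.uC := by
  obtain ⟨ζ, -, rfl⟩ := S.eq_I_smul_of_mem_iu hξ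
  rw [← Complex.coe_smul, smul_smul]
  exact S.conj_exp_mem_uC ζ.2 hA _

/-- The right logarithmic derivative of `s ↦ exp (t (ξ + s δ))` at `s = 0`. -/
theorem exists_logDeriv_exp (ξ δ : S.iu) : ∃ R : ℝ → (V →L[ℂ] V), R 0 = 0 ∧
    (∀ t, R t ∈ S.uC) ∧
    (∀ t, HasDerivAt R (δ + (ξ * R t - R t * ξ)) t) ∧
    ∀ t : ℝ, HasDerivAt (fun s : ℝ => NormedSpace.exp (t • ((ξ : V →L[ℂ] V) + s • δ)))
      (R t * NormedSpace.exp (t • (ξ : V →L[ℂ] V))) 0 := by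
  obtain ⟨D, hD0, hD, hD'⟩ := exists_deriv_exp (ξ : V →L[ℂ] V) δ
  have hE : ∀ t : ℝ, HasDerivAt (fun t : ℝ => NormedSpace.exp (-(t • (ξ : V →L[ℂ] V))))
      (-(NormedSpace.exp (-(t • (ξ : V →L[ℂ] V))) * ξ)) t := fun t => by
    simpa [smul_neg] using hasDerivAt_exp_smul' (-(ξ : V →L[ℂ] V)) t
  have hcomm : ∀ t : ℝ, NormedSpace.exp (-(t • (ξ : V →L[ℂ] V))) * (ξ : V →L[ℂ] V)
      = ξ * NormedSpace.exp (-(t • (ξ : V →L[ℂ] V))) := fun t => by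
    have h1 := hasDerivAt_exp_smul (-(ξ : V →L[ℂ] V)) t
    have h2 := hasDerivAt_exp_smul' (-(ξ : V →L[ℂ] V)) t
    simpa [smul_neg] using h2.unique h1
  refine ⟨fun t => D t * NormedSpace.exp (-(t • (ξ : V →L[ℂ] V))), by simp [hD0], fun t => ?_,
    fun t => ?_, fun t => ?_⟩
  -- This curve starts at `0` and has derivative `exp(-tξ) δ exp(tξ)`, which lies in `𝔲 ⊕ i𝔲`.
  · have hy : ∀ t : ℝ, NormedSpace.exp (-(t • (ξ : V →L[ℂ] V))) * D t ∈ S.uC := by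
      intro t
      refine S.mem_uC_of_forall_dual fun φ hφ => ?_
      have hder : ∀ t : ℝ, HasDerivAt
          (fun t : ℝ => φ (NormedSpace.exp (-(t • (ξ : V →L[ℂ] V))) * D t)) 0 t := by
        intro t
        have h1 := ((φ.restrictScalars ℝ).toContinuousLinearMap.hasFDerivAt).comp_hasDerivAt t
          ((hE t).mul (hD t))
        refine h1.congr_deriv ?_
        change φ _ = 0
        have h2 := hφ _ (S.conj_exp_iu_mem_uC ξ.2 (S.iu_le_uC δ.2) (-t))
        rw [neg_smul, neg_neg] at h2
        rw [← h2]
        congr 1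
        noncomm_ring
      have h3 := is_const_of_deriv_eq_zero (fun t => (hder t).differentiableAt)
        (fun t => (hder t).deriv) t 0
      rw [h3, hD0, mul_zero, map_zero]
    have := S.conj_exp_iu_mem_uC ξ.2 (hy t) t
    rwa [← mul_assoc, exp_mul_exp_neg, one_mul] at this
  · refine ((hD t).mul (hE t)).congr_deriv ?_
    rw [hcomm, add_mul, mul_assoc _ (NormedSpace.exp (t • (ξ : V →L[ℂ] V))), exp_mul_exp_neg,
      mul_assoc (D t), hcomm]
    noncomm_ring
  · have := hD' t
    rwa [mul_assoc, exp_neg_mul_exp, mul_one]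

variable [CompleteSpace V]

theorem isSelfAdjoint_of_mem_iu {ξ : V →L[ℂ] V} (hξ : ξ ∈ S.iu) : IsSelfAdjoint ξ := by
  obtain ⟨ζ, -, rfl⟩ := S.eq_I_smul_of_mem_iu hξ
  rw [isSelfAdjoint_iff, star_smul, S.star_eq_neg_of_mem_u ζ.2]
  simp

end CompatibleGroup

end Lie

/-- A product rule for the pairing of a curve of linear forms with a curve of vectors. -/
theorem hasDerivAt_dual_apply {W : Type*} [NormedAddCommGroup W] [NormedSpace ℝ W]
    [FiniteDimensional ℝ W] {N : ℝ → Module.Dual ℝ W} {n : W → ℝ} {ρ : ℝ → W} {ρ' : W} {t₀ : ℝ}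
    (hN : ∀ ζ, HasDerivAt (fun t => N t ζ) (n ζ) t₀) (hρ : HasDerivAt ρ ρ' t₀) :
    HasDerivAt (fun t => N t (ρ t)) (n (ρ t₀) + N t₀ ρ') t₀ := by
  set b := Module.finBasis ℝ W
  have hs : ∀ t, N t (ρ t) = N t (ρ t₀) + ∑ j, b.repr (ρ t - ρ t₀) j * N t (b j) := by
    intro t
    have h1 : N t (ρ t - ρ t₀) = ∑ j, b.repr (ρ t - ρ t₀) j * N t (b j) := by
      conv_lhs => rw [← b.sum_repr (ρ t - ρ t₀)]
      rw [map_sum]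
      exact Finset.sum_congr rfl fun j _ => by rw [map_smul, smul_eq_mul]
    rw [← h1, ← map_add]
    congr 1
    abel
  have h2 : ∀ j, HasDerivAt (fun t => b.repr (ρ t - ρ t₀) j) (b.repr ρ' j) t₀ := fun j =>
    ((b.coord j).toContinuousLinearMap.hasFDerivAt).comp_hasDerivAt t₀ (hρ.sub_const (ρ t₀))
  have h3 := (hN (ρ t₀)).add (HasDerivAt.fun_sum (u := Finset.univ)
    fun j _ => (h2 j).mul (hN (b j)))
  have h4 : HasDerivAt (fun t => N t (ρ t)) _ t₀ :=
    h3.congr_of_eventuallyEq (Eventually.of_forall hs)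
  refine h4.congr_deriv ?_
  congr 1
  conv_rhs => rw [← b.sum_repr ρ']
  rw [map_sum]
  refine Finset.sum_congr rfl fun j _ => ?_
  simp

/-! ### The differential of the Kempf–Ness function in exponential coordinates. -/

section

variable {V : Type*} [NormedAddCommGroup V] [InnerProductSpace ℂ V] [FiniteDimensional ℂ V]
  [CompleteSpace V]

namespace CompatibleGroup

variable (S : CompatibleGroup V)

/-- A linear map `𝔤𝔩(V) → 𝔲` which is `X + iη ↦ η` on `𝔲 ⊕ i𝔲`. -/
def imPart : (V →L[ℂ] V) →ₗ[ℝ] S.u :=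
  S.skewProj ∘ₗ DistribSMul.toLinearMap ℝ (V →L[ℂ] V) (-Complex.I)

theorem imPart_apply (A : V →L[ℂ] V) : S.imPart A = S.skewProj (-Complex.I • A) := rfl

theorem imPart_add_I_smul (X η : S.u) :
    S.imPart ((X : V →L[ℂ] V) + Complex.I • (η : V →L[ℂ] V)) = η := by
  rw [imPart_apply, smul_add, smul_smul, neg_mul, Complex.I_mul_I, neg_neg, one_smul, map_add,
    S.skewProj_coe, S.skewProj_of_isSelfAdjoint, zero_add]
  rw [isSelfAdjoint_iff, star_smul, S.star_eq_neg_of_mem_u X.2]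
  simp

theorem coe_imPart_of_mem_iu {ξ : V →L[ℂ] V} (hξ : ξ ∈ S.iu) :
    (S.imPart ξ : V →L[ℂ] V) = -Complex.I • ξ := by
  obtain ⟨ζ, h1, h2⟩ := S.eq_I_smul_of_mem_iu hξ
  rw [← h1, h2]
  have := S.imPart_add_I_smul 0 ζ
  rw [Submodule.coe_zero, zero_add] at this
  rw [this]

/-- With `ξ = iζ`, multiplying the commutator by `-i` gives `[ζ, X] + i[ζ, η]`, whose second term is
self-adjoint and so is killed by `skewProj`. -/
theorem imPart_commutator {ξ : V →L[ℂ] V} (hξ : ξ ∈ S.iu) (X η : S.u) :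
    S.imPart (ξ * ((X : V →L[ℂ] V) + Complex.I • (η : V →L[ℂ] V))
      - ((X : V →L[ℂ] V) + Complex.I • (η : V →L[ℂ] V)) * ξ)
      = S.skewProj ((S.imPart ξ : V →L[ℂ] V) * X - X * (S.imPart ξ : V →L[ℂ] V)) := by
  rw [S.coe_imPart_of_mem_iu hξ]
  obtain ⟨ζ, h1, h2⟩ := S.eq_I_smul_of_mem_iu hξ
  rw [← h1, h2, imPart_apply]
  have e : -Complex.I • (Complex.I • (ζ : V →L[ℂ] V) * ((X : V →L[ℂ] V)
      + Complex.I • (η : V →L[ℂ] V)) - ((X : V →L[ℂ] V) + Complex.I • (η : V →L[ℂ] V))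
        * (Complex.I • (ζ : V →L[ℂ] V))) = ((ζ : V →L[ℂ] V) * X - X * ζ)
        + Complex.I • ((ζ : V →L[ℂ] V) * η - η * ζ) := by
    simp only [mul_add, add_mul, smul_mul_assoc, mul_smul_comm, smul_sub, smul_add, smul_smul,
      neg_mul, mul_neg, Complex.I_mul_I, neg_neg, one_smul]
    module
  rw [e, map_add, add_eq_left]
  refine S.skewProj_of_isSelfAdjoint ?_
  rw [isSelfAdjoint_iff, star_smul, star_sub, star_mul, star_mul, S.star_eq_neg_of_mem_u ζ.2,
    S.star_eq_neg_of_mem_u η.2, neg_mul_neg, neg_mul_neg, ← neg_sub, smul_neg]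
  simp

theorem hasDerivAt_imPart {ρ : ℝ → (V →L[ℂ] V)} {ρ' : V →L[ℂ] V} {t : ℝ}
    (h : HasDerivAt ρ ρ' t) : HasDerivAt (fun t => S.imPart (ρ t)) (S.imPart ρ') t :=
  (S.imPart.toContinuousLinearMap.hasFDerivAt).comp_hasDerivAt t h

end CompatibleGroup

namespace HamiltonianKahler

variable {S : CompatibleGroup V} {E Z : Type*} [NormedAddCommGroup E] [NormedSpace ℂ E]
  [TopologicalSpace Z] [ChartedSpace E Z] [IsManifold 𝓘(ℂ, E) ω Z] [MulAction S.UC Z]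
  (H : HamiltonianKahler S E Z)

/-- The gradient map of the `U^ℂ`-action, extended to a linear form on `𝔤𝔩(V)`. -/
def grad (z : Z) : (V →L[ℂ] V) →ₗ[ℝ] ℝ := H.μ z ∘ₗ S.imPart

theorem grad_apply (z : Z) (A : V →L[ℂ] V) : H.grad z A = H.μ z (S.imPart A) := rfl

theorem contDiff_grad_expI (x : Z) :
    ContDiff ℝ ∞ fun q : S.iu × ℝ => H.grad (S.expI (q.2 • q.1) • x) q.1 := by
  set b := Module.finBasis ℝ S.u
  have hs : ∀ q : S.iu × ℝ, H.grad (S.expI (q.2 • q.1) • x) q.1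
      = ∑ j, b.repr (S.imPart q.1) j * H.μ (S.expI (q.2 • q.1) • x) (b j) := by
    intro q
    rw [grad_apply]
    conv_lhs => rw [← b.sum_repr (S.imPart q.1)]
    rw [map_sum]
    exact Finset.sum_congr rfl fun j _ => by rw [map_smul, smul_eq_mul]
  simp only [hs]
  refine ContDiff.sum fun j _ => ContDiff.mul ?_ ?_
  · exact ((b.coord j ∘ₗ S.imPart ∘ₗ S.iu.subtype).toContinuousLinearMap.contDiff).comp
      contDiff_fst
  · refine H.contDiff_moment_comp (c := fun q : S.iu × ℝ => S.expI (q.2 • q.1)) ?_ x (b j)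
    exact contDiff_exp_End.comp
      (contDiff_snd.smul ((S.iu.subtypeL.contDiff).comp contDiff_fst))

/-- The Kempf–Ness function in the coordinates `exp : i𝔲 → U^ℂ/U`. -/
def kempfNessExp (x : Z) (ξ : S.iu) : ℝ :=
  ∫ t in (0 : ℝ)..1, H.grad (S.expI (t • ξ) • x) ξ

-- Let `R t` be the right logarithmic derivative in `s` of `exp(t(ξ + sδ))`. The `δ`-derivative of
-- the integrand equals the `t`-derivative of `grad(exp(tξ)x)(R t)`, so the integral is the boundary
-- term at `t = 1`. The equality expresses that the form being integrated is closed; it follows from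
-- symmetry of `h` and `imPart_commutator`.
set_option maxHeartbeats 1000000 in
theorem exists_hasFDerivAt_kempfNessExp (x : Z) (ξ : S.iu) : ∃ F' : S.iu →L[ℝ] ℝ,
    HasFDerivAt (H.kempfNessExp x) F' ξ ∧
    ∀ δ : S.iu, F' δ = H.grad (S.expI ξ • x)
      (fderiv ℝ NormedSpace.exp (ξ : V →L[ℂ] V) δ * NormedSpace.exp (-(ξ : V →L[ℂ] V))) := by
  have hc : ContDiff ℝ 1 fun q : S.iu × ℝ => H.grad (S.expI (q.2 • q.1) • x) q.1 :=
    (H.contDiff_grad_expI x).of_le (by simp)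
  set f : S.iu × ℝ → ℝ := fun q => H.grad (S.expI (q.2 • q.1) • x) q.1 with hf
  have h1 := hasFDerivAt_intervalIntegral_of_contDiff hc ξ
  refine ⟨_, h1, fun δ => ?_⟩
  have hcont : Continuous fun t : ℝ => (fderiv ℝ f (ξ, t)).comp
      (ContinuousLinearMap.inl ℝ S.iu ℝ) :=
    ((hc.continuous_fderiv one_ne_zero).comp (by fun_prop)).clm_comp continuous_const
  rw [ContinuousLinearMap.intervalIntegral_apply (hcont.intervalIntegrable _ _)]
  obtain ⟨R, hR0, hRm, hR, hR'⟩ := S.exists_logDeriv_exp ξ δ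
  have hcurve : ∀ t : ℝ, HasDerivAt (fun t : ℝ => S.toEnd (S.expI (t • ξ)))
      (ξ * S.toEnd (S.expI (t • ξ))) t := fun t => hasDerivAt_exp_smul (ξ : V →L[ℂ] V) t
  have hinv : ∀ g : S.UC, S.toEnd g * S.toEnd g⁻¹ = 1 := fun g => Units.mul_inv _
  have key : ∀ t : ℝ, HasDerivAt (fun t : ℝ => H.grad (S.expI (t • ξ) • x) (R t))
      ((fderiv ℝ f (ξ, t)).comp (ContinuousLinearMap.inl ℝ S.iu ℝ) δ) t := by
    intro t
    obtain ⟨X, η, hXη⟩ := hRm t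
    have ha : HasDerivAt (fun s : ℝ => f (ξ + s • δ, t))
        ((fderiv ℝ f (ξ, t)).comp (ContinuousLinearMap.inl ℝ S.iu ℝ) δ) 0 := by
      have h2 : HasDerivAt (fun s : ℝ => ((ξ + s • δ, t) : S.iu × ℝ)) (δ, 0) 0 := by
        refine HasDerivAt.prodMk ?_ (hasDerivAt_const _ _)
        simpa using ((hasDerivAt_id' (0 : ℝ)).smul_const δ).const_add ξ
      have h3 : HasFDerivAt f (fderiv ℝ f (ξ, t)) (ξ + (0 : ℝ) • δ, t) := by
        rw [zero_smul, add_zero]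
        exact (hc.differentiable one_ne_zero (ξ, t)).hasFDerivAt
      exact h3.comp_hasDerivAt (f := fun s : ℝ => ((ξ + s • δ, t) : S.iu × ℝ)) (0 : ℝ) h2
    -- Varying `s`: the point moves with logarithmic derivative `R t = X + iη`, and the argument of
    -- the linear form moves by `δ`.
    have hb : HasDerivAt (fun s : ℝ => f (ξ + s • δ, t))
        ((H.μ (S.expI (t • ξ) • x) (S.skewProj ((S.imPart ξ : V →L[ℂ] V) * X
          - X * (S.imPart ξ : V →L[ℂ] V)))
        + H.fundInner (S.expI (t • ξ) • x) (S.imPart ξ) η)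
        + H.μ (S.expI (t • ξ) • x) (S.imPart δ)) 0 := by
      have h4 : HasDerivAt (fun s : ℝ => S.toEnd (S.expI (t • (ξ + s • δ))))
          (R t * S.toEnd (S.expI (t • ξ))) 0 := hR' t
      have h5 : R t * S.toEnd (S.expI (t • ξ)) * S.toEnd (S.expI (t • (ξ + (0 : ℝ) • δ)))⁻¹
          = X + Complex.I • (η : V →L[ℂ] V) := by
        rw [zero_smul, add_zero, mul_assoc, hinv, mul_one, hXη]
      have h6 := fun ζ => H.hasDerivAt_moment_comp h4 h5 x ζ
      have h7 : HasDerivAt (fun s : ℝ => S.imPart ((ξ : V →L[ℂ] V) + s • (δ : V →L[ℂ] V)))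
          (S.imPart δ) 0 := by
        refine S.hasDerivAt_imPart ?_
        simpa using ((hasDerivAt_id' (0 : ℝ)).smul_const (δ : V →L[ℂ] V)).const_add
          (ξ : V →L[ℂ] V)
      have h8 := hasDerivAt_dual_apply h6 h7
      simp only [zero_smul, add_zero] at h8
      exact h8
    rw [ha.unique hb]
    have h9 : ξ * S.toEnd (S.expI (t • ξ)) * S.toEnd (S.expI (t • ξ))⁻¹
        = (0 : S.u) + Complex.I • (S.imPart ξ : V →L[ℂ] V) := by
      rw [mul_assoc, hinv, mul_one, S.coe_imPart_of_mem_iu ξ.2, smul_smul, mul_neg,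
        Complex.I_mul_I, neg_neg, one_smul, Submodule.coe_zero, zero_add]
    -- Varying `t`: the point moves with logarithmic derivative `ξ`, and `R` has derivative `δ + [ξ,
    -- R]`.
    have h10 := hasDerivAt_dual_apply (fun ζ => H.hasDerivAt_moment_comp (hcurve t) h9 x ζ)
      (S.hasDerivAt_imPart (hR t))
    refine h10.congr_deriv ?_
    rw [map_add S.imPart, hXη, S.imPart_commutator ξ.2, S.imPart_add_I_smul]
    simp only [Submodule.coe_zero, mul_zero, zero_mul, sub_zero, map_zero, zero_add, map_add]
    rw [H.fundInner_comm]
    ring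
  rw [intervalIntegral.integral_eq_sub_of_hasDerivAt (fun t _ => key t)
    ((hcont.clm_apply continuous_const).intervalIntegrable _ _)]
  have h11 := hR' 1
  have h12 : HasDerivAt (fun s : ℝ => NormedSpace.exp ((1 : ℝ) • ((ξ : V →L[ℂ] V) + s • δ)))
      (fderiv ℝ NormedSpace.exp (ξ : V →L[ℂ] V) δ) 0 := by
    have h13 : HasDerivAt (fun s : ℝ => (1 : ℝ) • ((ξ : V →L[ℂ] V) + s • (δ : V →L[ℂ] V)))
        (δ : V →L[ℂ] V) 0 := by
      simpa using ((hasDerivAt_id' (0 : ℝ)).smul_const (δ : V →L[ℂ] V)).const_add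
          (ξ : V →L[ℂ] V)
    have h14 : HasFDerivAt NormedSpace.exp (fderiv ℝ NormedSpace.exp (ξ : V →L[ℂ] V))
        ((1 : ℝ) • ((ξ : V →L[ℂ] V) + (0 : ℝ) • (δ : V →L[ℂ] V))) := by
      rw [zero_smul, add_zero, one_smul]
      exact (contDiff_exp_End.differentiable one_ne_zero _).hasFDerivAt
    exact h14.comp_hasDerivAt (0 : ℝ) h13
  rw [h12.unique h11, hR0, map_zero, sub_zero, one_smul, one_smul, mul_assoc, exp_mul_exp_neg,
    mul_one]

/-- The gradient map is monotone along the gradient flow. -/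
theorem hasDerivAt_grad_exp (x : Z) (ξ : S.iu) (t : ℝ) :
    HasDerivAt (fun t : ℝ => H.grad (S.expI (t • ξ) • x) ξ)
      (H.fundInner (S.expI (t • ξ) • x) (S.imPart ξ) (S.imPart ξ)) t := by
  have hcurve : HasDerivAt (fun t : ℝ => S.toEnd (S.expI (t • ξ)))
      (ξ * S.toEnd (S.expI (t • ξ))) t := hasDerivAt_exp_smul (ξ : V →L[ℂ] V) t
  have hinv : ∀ g : S.UC, S.toEnd g * S.toEnd g⁻¹ = 1 := fun g => Units.mul_inv _
  have h9 : ξ * S.toEnd (S.expI (t • ξ)) * S.toEnd (S.expI (t • ξ))⁻¹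
      = (0 : S.u) + Complex.I • (S.imPart ξ : V →L[ℂ] V) := by
    rw [mul_assoc, hinv, mul_one, S.coe_imPart_of_mem_iu ξ.2, smul_smul, mul_neg,
      Complex.I_mul_I, neg_neg, one_smul, Submodule.coe_zero, zero_add]
  refine (H.hasDerivAt_moment_comp hcurve h9 x (S.imPart ξ)).congr_deriv ?_
  simp

end HamiltonianKahler

end

/-! ### Polar decomposition in `G`. -/

section

variable {V : Type*} [NormedAddCommGroup V] [InnerProductSpace ℂ V] [FiniteDimensional ℂ V]

namespace CompatibleGroup

variable (S : CompatibleGroup V)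

theorem expG_zero (β : S.p) : S.expG β 0 = 1 := by
  ext1
  apply Units.ext
  simp [expG, coe_expU]

theorem expG_add (β : S.p) (s t : ℝ) : S.expG β (s + t) = S.expG β s * S.expG β t := by
  have : CompleteSpace V := FiniteDimensional.complete ℂ V
  let _ : NormedAlgebra ℚ (V →L[ℂ] V) := NormedAlgebra.restrictScalars ℚ ℂ _
  ext1
  apply Units.ext
  change NormedSpace.exp ((s + t) • (β : V →L[ℂ] V)) = NormedSpace.exp _ * NormedSpace.exp _
  rw [add_smul, NormedSpace.exp_add_of_commute]
  exact ((Commute.refl _).smul_left s).smul_right t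

theorem expG_inv (β : S.p) (t : ℝ) : (S.expG β t)⁻¹ = S.expG β (-t) := by
  rw [inv_eq_iff_mul_eq_one, ← expG_add, add_neg_cancel, expG_zero]

/-- An element of `G` as an endomorphism of `V`. -/
abbrev endG (g : S.G) : V →L[ℂ] V := ((g : (V →L[ℂ] V)ˣ) : V →L[ℂ] V)

theorem endG_mul_inv (g : S.G) : S.endG g * S.endG g⁻¹ = 1 := Units.mul_inv _

theorem endG_inv_mul (g : S.G) : S.endG g⁻¹ * S.endG g = 1 := Units.inv_mul _

theorem polar_spec (g : S.G) : ∃ k ∈ S.K, g = k * S.expG (S.polar g) 1 := by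
  obtain ⟨k, hk, β, hβ, h⟩ := S.compatible g g.2
  have hex : ∃ ξ : S.p, ∃ k ∈ S.K, g = k * S.expG ξ 1 := by
    refine ⟨⟨β, hβ⟩, ⟨k, hk.1⟩, Subgroup.mem_subgroupOf.2 hk.2, ?_⟩
    ext1
    rw [h]
    change k * expU β = k * expU ((1 : ℝ) • β)
    rw [one_smul]
  exact Classical.epsilon_spec hex

theorem norm_endG_le_one {k : S.G} (hk : k ∈ S.K) : ‖S.endG k‖ ≤ 1 :=
  ContinuousLinearMap.opNorm_le_bound _ zero_le_one fun v => by
    rw [one_mul]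
    exact (S.unitary_U _ (Subgroup.mem_subgroupOf.1 hk) v).le

/-- The inclusion `𝔭 → i𝔲`. -/
def ofP (β : S.p) : S.iu := ⟨β, S.p_le_iu β.2⟩

variable [CompleteSpace V]

theorem imPart_eq_zero_of_star_eq_neg {A : V →L[ℂ] V} (hA : star A = -A) : S.imPart A = 0 := by
  rw [imPart_apply, S.skewProj_of_isSelfAdjoint]
  rw [isSelfAdjoint_iff, star_smul, hA]
  simp

/-- For unitary `u`, `u - 1 = (u - u*)/2 - (u - 1)*(u - 1)/2`, and the first term is skew-adjoint. A
unitary factor near `1` thus contributes only to second order. -/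
theorem imPart_unitary_sub_one {u : V →L[ℂ] V} (hu : star u * u = 1) :
    S.imPart (u - 1) = -((1 / 2 : ℝ) • S.imPart (star (u - 1) * (u - 1))) := by
  have h1 : S.imPart (u - star u) = 0 := S.imPart_eq_zero_of_star_eq_neg (by simp)
  have h2 : u - 1 = (1 / 2 : ℝ) • (u - star u) - (1 / 2 : ℝ) • (star (u - 1) * (u - 1)) := by
    have e : star (u - 1) * (u - 1) = (2 : ℝ) • (1 : V →L[ℂ] V) - u - star u := by
      rw [star_sub, star_one, sub_mul, mul_sub, hu, two_smul]
      noncomm_ring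
    rw [e]
    module
  conv_lhs => rw [h2]
  rw [map_sub, map_smul, h1, map_smul, smul_zero, zero_sub]

/-- Elements of `G` whose quotient is close to `K` have close polar parts. -/
theorem norm_polar_sub_le {g k k' : S.G} {ξ : S.p} {w : V →L[ℂ] V} {w' : V →L[ℂ] V} {c : ℝ}
    (hc : 0 ≤ c) (hk : k ∈ S.K) (hk' : k' ∈ S.K) (hw : w' * w = 1)
    (hg : S.endG g = S.endG k' * w * S.endG k * NormedSpace.exp (ξ : V →L[ℂ] V))
    (h1 : ‖w‖ ≤ Real.exp c) (h2 : ‖w'‖ ≤ Real.exp c) :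
    ‖(S.polar g : V →L[ℂ] V) - ξ‖ ≤ 3 * c := by
  obtain ⟨k₁, hk₁, h⟩ := S.polar_spec g
  have hs : ∀ ξ : S.p, IsSelfAdjoint (ξ : V →L[ℂ] V) := fun ξ =>
    S.isSelfAdjoint_of_mem_iu (S.p_le_iu ξ.2)
  have e1 : S.endG g = S.endG k₁ * NormedSpace.exp (S.polar g : V →L[ℂ] V) := by
    conv_lhs => rw [h]
    rw [← one_smul ℝ (S.polar g : V →L[ℂ] V)]
    rfl
  have e2 : NormedSpace.exp (S.polar g : V →L[ℂ] V)
      = S.endG (k₁⁻¹ * k') * (w * S.endG k) * NormedSpace.exp (ξ : V →L[ℂ] V) := by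
    have e3 : S.endG (k₁⁻¹ * k') = S.endG k₁⁻¹ * S.endG k' := rfl
    calc NormedSpace.exp (S.polar g : V →L[ℂ] V) = S.endG k₁⁻¹ * S.endG g := by
          rw [e1, ← mul_assoc, endG_inv_mul, one_mul]
      _ = _ := by rw [hg, e3]; simp only [mul_assoc]
  refine norm_sub_le_of_exp_eq hc (hs _) (hs _)
    (k := S.endG (k₁⁻¹ * k')) (w := w * S.endG k) (w' := S.endG k⁻¹ * w') ?_ ?_ e2 ?_ ?_
  · exact S.star_mul_self_of_mem_U
      (Subgroup.mem_subgroupOf.1 (S.K.mul_mem (S.K.inv_mem hk₁) hk'))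
  · rw [mul_assoc, ← mul_assoc w', hw, one_mul, endG_inv_mul]
  · refine (norm_mul_le _ _).trans ?_
    have := mul_le_mul h1 (S.norm_endG_le_one hk) (norm_nonneg _) (Real.exp_nonneg c)
    rwa [mul_one] at this
  · refine (norm_mul_le _ _).trans ?_
    have := mul_le_mul (S.norm_endG_le_one (S.K.inv_mem hk)) h2 (norm_nonneg _) zero_le_one
    rwa [one_mul] at this

end CompatibleGroup

namespace HamiltonianKahler

variable {S : CompatibleGroup V} {E Z : Type*} [NormedAddCommGroup E] [NormedSpace ℂ E]
  [TopologicalSpace Z] [ChartedSpace E Z] [IsManifold 𝓘(ℂ, E) ω Z] [MulAction S.UC Z]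
  (H : HamiltonianKahler S E Z)

theorem act_mul (g g' : S.G) (x : Z) : H.act (g * g') x = H.act g (H.act g' x) := by
  unfold act
  rw [map_mul, mul_smul]

theorem act_expG (β : S.p) (t : ℝ) (x : Z) :
    H.act (S.expG β t) x = S.expI (t • S.ofP β) • x := rfl

variable [CompleteSpace V]

theorem gradientMap_eq (z : Z) (β : S.p) : H.gradientMap z β = H.grad z β := by
  rw [gradientMap, grad_apply]
  congr 1
  exact Subtype.ext (S.coe_imPart_of_mem_iu (S.p_le_iu β.2)).symm

theorem kempfNess_eq (x : Z) (g : S.G) :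
    H.kempfNess x g = H.kempfNessExp x (S.ofP (S.polar g)) := by
  unfold kempfNess kempfNessExp
  refine intervalIntegral.integral_congr fun t _ => ?_
  rw [gradientMap_eq]
  rfl

theorem grad_act (k : S.G) (hk : k ∈ S.K) (z : Z) (β : S.p) :
    H.grad (H.act k z) β = H.grad z (S.endG k⁻¹ * (β : V →L[ℂ] V) * S.endG k) := by
  have hU : ((k⁻¹ : S.G) : (V →L[ℂ] V)ˣ) ∈ S.U := Subgroup.mem_subgroupOf.1 (S.K.inv_mem hk)
  have hβ := S.p_le_iu β.2
  obtain ⟨ζ, h1, h2⟩ := S.eq_I_smul_of_mem_iu hβ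
  have hm := S.conj_mem_u hU ζ.2
  have e := H.equivariant (Subgroup.inclusion S.G_le k⁻¹) hU (H.act k z) ζ ⟨_, hm⟩ rfl
  have e1 : Subgroup.inclusion S.G_le k⁻¹ • H.act k z = z := by
    unfold act
    rw [map_inv, inv_smul_smul]
  rw [e1] at e
  rw [grad_apply, grad_apply]
  have e2 : S.imPart (β : V →L[ℂ] V) = ζ :=
    Subtype.ext ((S.coe_imPart_of_mem_iu hβ).trans h1.symm)
  rw [e2, ← e]
  congr 1
  have e3 := S.imPart_add_I_smul 0 ⟨_, hm⟩
  rw [← e3, h2, Submodule.coe_zero, zero_add]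
  congr 1
  simp only [mul_smul_comm, smul_mul_assoc, InvMemClass.coe_inv, inv_inv]
  rfl

end HamiltonianKahler

end

/-! ### The derivative of the Kempf–Ness function on `G`. -/

section

open Asymptotics

variable {V : Type*} [NormedAddCommGroup V] [InnerProductSpace ℂ V] [FiniteDimensional ℂ V]
  [CompleteSpace V]

/-- A linear form which vanishes on skew-adjoint operators only sees the self-adjoint factor of a
product `u exp (s β)`, to first order. -/
theorem isLittleO_unitary_mul_exp (f : (V →L[ℂ] V) →ₗ[ℝ] ℝ)
    (hf : ∀ u : V →L[ℂ] V, star u * u = 1 →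
      f (u - 1) = -((1 / 2 : ℝ) * f (star (u - 1) * (u - 1))))
    (β : V →L[ℂ] V) (u q : ℝ → (V →L[ℂ] V)) (hu : ∀ s, star (u s) * u s = 1)
    (hq : ∀ s, q s = u s * NormedSpace.exp (s • β))
    (hq1 : (fun s => q s - 1) =O[𝓝 0] fun s : ℝ => s) :
    (fun s => f (q s - 1) - s * f β) =o[𝓝 0] fun s : ℝ => s := by
  have hfO : ∀ {A : ℝ → (V →L[ℂ] V)}, (fun s => f (A s)) =O[𝓝 (0 : ℝ)] A := fun {A} =>
    (f.toContinuousLinearMap).isBigO_comp A _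
  have he0 : HasDerivAt (fun s : ℝ => NormedSpace.exp (s • β)) β 0 := by
    simpa using hasDerivAt_exp_smul β 0
  have he1 : (fun s : ℝ => NormedSpace.exp (s • β) - 1 - s • β) =o[𝓝 0] fun s : ℝ => s := by
    simpa using he0.isLittleO
  have he2 : (fun s : ℝ => NormedSpace.exp (s • β) - 1) =O[𝓝 0] fun s : ℝ => s := by
    simpa using he0.differentiableAt.isBigO_sub
  have he3 : (fun s : ℝ => NormedSpace.exp (-(s • β))) =O[𝓝 0] fun _ : ℝ => (1 : ℝ) := by
    have h1 : HasDerivAt (fun s : ℝ => NormedSpace.exp (s • (-β))) (-β) 0 := by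
      simpa using hasDerivAt_exp_smul (-β) 0
    simp only [← smul_neg]
    exact h1.continuousAt.isBigO_one ℝ
  have hu1 : (fun s => u s - 1) =O[𝓝 0] fun s : ℝ => s := by
    have e : ∀ s, u s - 1 = ((q s - 1) - (NormedSpace.exp (s • β) - 1))
        * NormedSpace.exp (-(s • β)) := fun s => by
      rw [hq, sub_sub_sub_cancel_right, sub_mul, mul_assoc, exp_mul_exp_neg, mul_one]
    simp only [e]
    simpa using (hq1.sub he2).mul he3
  have hsq : ∀ {a b : ℝ → (V →L[ℂ] V)}, a =O[𝓝 0] (fun s : ℝ => s) → b =O[𝓝 0] (fun s : ℝ => s) →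
      (fun s => a s * b s) =o[𝓝 0] fun s : ℝ => s := by
    intro a b ha hb
    refine (ha.mul hb).trans_isLittleO ?_
    have : (fun s : ℝ => s) =o[𝓝 0] fun _ : ℝ => (1 : ℝ) := by
      rw [isLittleO_one_iff]
      exact tendsto_id
    simpa using (isBigO_refl (fun s : ℝ => s) (𝓝 0)).mul_isLittleO this
  have hstar : (fun s => star (u s - 1)) =O[𝓝 0] fun s : ℝ => s := by
    refine IsBigO.trans (IsBigO.of_bound 1 (Eventually.of_forall fun s => ?_)) hu1
    rw [norm_star, one_mul]
  -- Three negligible terms: the quadratic defect of `u`, the Taylor remainder of the exponential,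
  -- and the product of two `O(s)` factors.
  have e : ∀ s, f (q s - 1) - s * f β = -((1 / 2 : ℝ) * f (star (u s - 1) * (u s - 1)))
      + f (NormedSpace.exp (s • β) - 1 - s • β)
      + f ((u s - 1) * (NormedSpace.exp (s • β) - 1)) := by
    intro s
    rw [← hf _ (hu s), ← smul_eq_mul, ← map_smul, ← map_sub, ← map_add, ← map_add, hq]
    congr 1
    noncomm_ring
  simp only [e]
  refine ((IsLittleO.neg_left ?_).add (hfO.trans_isLittleO he1)).add
    (hfO.trans_isLittleO (hsq hu1 he2))
  exact (hfO.trans_isLittleO (hsq hstar hu1)).const_mul_left _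

namespace HamiltonianKahler

variable {S : CompatibleGroup V} {E Z : Type*} [NormedAddCommGroup E] [NormedSpace ℂ E]
  [TopologicalSpace Z] [ChartedSpace E Z] [IsManifold 𝓘(ℂ, E) ω Z] [MulAction S.UC Z]
  (H : HamiltonianKahler S E Z)

/-- Write `exp(sβ)g = k_s exp(ξ_s)` and `η = ξ_0`. Since `ξ_s - η = O(s)`, the change of `Φ` is, up
to `o(s)`, the gradient form at `exp(η)x` evaluated on `exp(ξ_s)exp(-η) - 1`. That product is the
unitary `k_s⁻¹k_0` times `exp(s k_0⁻¹βk_0)`, so only `s k_0⁻¹βk_0` counts to first order. No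
differentiability of `s ↦ ξ_s` is needed. -/
theorem hasDerivAt_kempfNess_zero (x : Z) (g : S.G) (β : S.p) :
    HasDerivAt (fun s => H.kempfNess x (S.expG β s * g)) (H.grad (H.act g x) β) 0 := by
  choose k hk hkg using fun s : ℝ => S.polar_spec (S.expG β s * g)
  set ξ : ℝ → S.p := fun s => S.polar (S.expG β s * g) with hξ
  set η : S.iu := S.ofP (ξ 0) with hη
  have hexp : ∀ s, S.endG (S.expG β s * g)
      = S.endG (k s) * NormedSpace.exp (ξ s : V →L[ℂ] V) := fun s => by
    conv_lhs => rw [hkg s]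
    rw [← one_smul ℝ (ξ s : V →L[ℂ] V)]
    rfl
  have hg0 : g = k 0 * S.expG (ξ 0) 1 := by
    rw [← hkg 0, S.expG_zero, one_mul]
  have hgE : S.endG g = S.endG (k 0) * NormedSpace.exp (ξ 0 : V →L[ℂ] V) := by
    rw [← hexp 0, S.expG_zero, one_mul]
  have hsE : ∀ s, S.endG (S.expG β s * g)
      = NormedSpace.exp (s • (β : V →L[ℂ] V)) * (S.endG (k 0) *
        NormedSpace.exp (ξ 0 : V →L[ℂ] V)) := fun s => by
    rw [← hgE]; rfl
  have hbd : ∀ s : ℝ, ‖(ξ s : V →L[ℂ] V) - ξ 0‖ ≤ 3 * (|s| * ‖(β : V →L[ℂ] V)‖) := fun s => by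
    have hn : ∀ r : ℝ, ‖r • (β : V →L[ℂ] V)‖ = |r| * ‖(β : V →L[ℂ] V)‖ := fun r => norm_smul _ _
    refine S.norm_polar_sub_le (k' := 1) (k := k 0) (w := NormedSpace.exp (s • (β : V →L[ℂ] V)))
      (w' := NormedSpace.exp (-(s • (β : V →L[ℂ] V)))) (by positivity) (hk 0) S.K.one_mem
      (exp_neg_mul_exp _) ?_ ?_ ?_
    · rw [hsE, show S.endG 1 = 1 from rfl, one_mul, mul_assoc]
    · exact (norm_exp_le_exp_norm _).trans (by rw [hn])
    · exact (norm_exp_le_exp_norm _).trans (by rw [norm_neg, hn])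
  have hδ : (fun s => S.ofP (ξ s) - η) =O[𝓝 0] fun s : ℝ => s := by
    refine IsBigO.of_bound (3 * ‖(β : V →L[ℂ] V)‖) (Eventually.of_forall fun s => ?_)
    refine (hbd s).trans (le_of_eq ?_)
    rw [Real.norm_eq_abs]; ring
  have hδ0 : Tendsto (fun s => S.ofP (ξ s)) (𝓝 0) (𝓝 η) := by
    rw [← tendsto_sub_nhds_zero_iff]
    exact hδ.trans_tendsto tendsto_id
  have hδ0' : Tendsto (fun s => (ξ s : V →L[ℂ] V)) (𝓝 0) (𝓝 (η : V →L[ℂ] V)) :=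
    (S.iu.subtypeL.continuous.tendsto η).comp hδ0
  have hδ' : (fun s => (ξ s : V →L[ℂ] V) - η) =O[𝓝 0] fun s : ℝ => s :=
    IsBigO.trans (IsBigO.of_bound 1 (Eventually.of_forall fun s => by rw [one_mul]; rfl)) hδ
  obtain ⟨F', hF', hF''⟩ := H.exists_hasFDerivAt_kempfNessExp x η
  have hF : (fun s => H.kempfNessExp x (S.ofP (ξ s)) - H.kempfNessExp x η
      - F' (S.ofP (ξ s) - η)) =o[𝓝 0] fun s : ℝ => s :=
    (hF'.isLittleO.comp_tendsto hδ0).trans_isBigO hδ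
  have hTd : HasFDerivAt NormedSpace.exp (fderiv ℝ NormedSpace.exp (η : V →L[ℂ] V))
      (η : V →L[ℂ] V) := (contDiff_exp_End.differentiable one_ne_zero _).hasFDerivAt
  have hT : (fun s => NormedSpace.exp (ξ s : V →L[ℂ] V) - NormedSpace.exp (η : V →L[ℂ] V)
      - fderiv ℝ NormedSpace.exp (η : V →L[ℂ] V) ((ξ s : V →L[ℂ] V) - η))
      =o[𝓝 0] fun s : ℝ => s :=
    (hTd.isLittleO.comp_tendsto hδ0').trans_isBigO hδ'
  have hTO : (fun s => NormedSpace.exp (ξ s : V →L[ℂ] V) - NormedSpace.exp (η : V →L[ℂ] V))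
      =O[𝓝 0] fun s : ℝ => s :=
    ((hTd.isBigO_sub).comp_tendsto hδ0').trans hδ'
  set z := S.expI η • x with hz
  set q : ℝ → (V →L[ℂ] V) := fun s =>
    NormedSpace.exp (ξ s : V →L[ℂ] V) * NormedSpace.exp (-(η : V →L[ℂ] V)) with hq
  have hq1 : ∀ s, q s - 1 = (NormedSpace.exp (ξ s : V →L[ℂ] V)
      - NormedSpace.exp (η : V →L[ℂ] V)) * NormedSpace.exp (-(η : V →L[ℂ] V)) := fun s => by
    rw [sub_mul, exp_mul_exp_neg]
  have hqO : (fun s => q s - 1) =O[𝓝 0] fun s : ℝ => s := by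
    simp only [hq1]
    simpa using hTO.mul (isBigO_refl (fun _ : ℝ => NormedSpace.exp (-(η : V →L[ℂ] V)))
      (𝓝 0) |>.trans (isBigO_const_const _ (one_ne_zero (α := ℝ)) _))
  set γ : V →L[ℂ] V := S.endG (k 0)⁻¹ * (β : V →L[ℂ] V) * S.endG (k 0) with hγ
  have hexpγ : ∀ s : ℝ, NormedSpace.exp (s • γ)
      = S.endG (k 0)⁻¹ * NormedSpace.exp (s • (β : V →L[ℂ] V)) * S.endG (k 0) := fun s => by
    have := congrArg (fun u : (V →L[ℂ] V)ˣ => (u : V →L[ℂ] V))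
      (expU_conj ((k 0)⁻¹ : S.G) (s • (β : V →L[ℂ] V)))
    simp only [InvMemClass.coe_inv, inv_inv] at this
    rw [hγ, ← smul_mul_assoc, ← mul_smul_comm]
    exact this
  have hqu : ∀ s, q s = S.endG ((k s)⁻¹ * k 0) * NormedSpace.exp (s • γ) := fun s => by
    have e1 : S.endG ((k s)⁻¹ * k 0) = S.endG (k s)⁻¹ * S.endG (k 0) := rfl
    have e2 : NormedSpace.exp (ξ s : V →L[ℂ] V) = S.endG (k s)⁻¹ *
        (NormedSpace.exp (s • (β : V →L[ℂ] V)) * (S.endG (k 0) *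
        NormedSpace.exp (ξ 0 : V →L[ℂ] V))) := by
      rw [← hsE, hexp, ← mul_assoc, S.endG_inv_mul, one_mul]
    calc q s = S.endG (k s)⁻¹ * NormedSpace.exp (s • (β : V →L[ℂ] V)) * S.endG (k 0) *
        (NormedSpace.exp (ξ 0 : V →L[ℂ] V) * NormedSpace.exp (-(ξ 0 : V →L[ℂ] V))) := by
          simp only [hq, e2, mul_assoc]; rfl
      _ = S.endG (k s)⁻¹ * (S.endG (k 0) * S.endG (k 0)⁻¹) *
          NormedSpace.exp (s • (β : V →L[ℂ] V)) * S.endG (k 0) := by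
          rw [exp_mul_exp_neg, S.endG_mul_inv, mul_one, mul_one]
      _ = _ := by rw [hexpγ, e1]; simp only [mul_assoc]
  have hmain := isLittleO_unitary_mul_exp (H.grad z) (fun u hu => by
    rw [grad_apply, S.imPart_unitary_sub_one hu, map_neg, map_smul, smul_eq_mul, grad_apply])
    γ (fun s => S.endG ((k s)⁻¹ * k 0)) q
    (fun s => S.star_mul_self_of_mem_U
      (Subgroup.mem_subgroupOf.1 (S.K.mul_mem (S.K.inv_mem (hk s)) (hk 0)))) hqu hqO
  have hT2 : (fun s => H.grad z ((NormedSpace.exp (ξ s : V →L[ℂ] V)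
      - NormedSpace.exp (η : V →L[ℂ] V)
      - fderiv ℝ NormedSpace.exp (η : V →L[ℂ] V) ((ξ s : V →L[ℂ] V) - η))
      * NormedSpace.exp (-(η : V →L[ℂ] V)))) =o[𝓝 0] fun s : ℝ => s := by
    refine IsBigO.trans_isLittleO ((H.grad z).toContinuousLinearMap.isBigO_comp _ _) ?_
    simpa using hT.mul_isBigO (isBigO_refl (fun _ : ℝ => NormedSpace.exp (-(η : V →L[ℂ] V)))
      (𝓝 0) |>.trans (isBigO_const_const _ (one_ne_zero (α := ℝ)) _))
  have hgrad : H.grad (H.act g x) β = H.grad z γ := by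
    conv_lhs => rw [hg0]
    rw [act_mul, grad_act _ _ (hk 0), act_expG, one_smul]
  rw [hasDerivAt_iff_isLittleO]
  refine ((hF.sub hT2).add hmain).congr (fun s => ?_) fun s => (sub_zero s).symm
  have e1 : F' (S.ofP (ξ s) - η) = H.grad z (fderiv ℝ NormedSpace.exp (η : V →L[ℂ] V)
      ((ξ s : V →L[ℂ] V) - η) * NormedSpace.exp (-(η : V →L[ℂ] V))) := hF'' _
  have e2 : ∀ A B C : V →L[ℂ] V, H.grad z ((A - B) * C) = H.grad z (A * C) - H.grad z (B * C) :=
    fun A B C => by rw [sub_mul, map_sub]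
  rw [e1, hgrad, H.kempfNess_eq, H.kempfNess_eq, hq1, e2 (_ - _) (fderiv ℝ _ _ _), sub_zero,
    smul_eq_mul]
  simp only [hξ, hη]
  ring

end HamiltonianKahler

end

/-! ### The distance on `M` controls operator norms. -/

section

variable {V : Type*} [NormedAddCommGroup V] [InnerProductSpace ℂ V] [FiniteDimensional ℂ V]

namespace CompatibleGroup

variable (S : CompatibleGroup V)

theorem re_B_pos {v : V →L[ℂ] V} (hv : v ∈ S.p) (h0 : v ≠ 0) : 0 < (S.B v v).re := by
  obtain ⟨ζ, -, rfl⟩ := S.eq_I_smul_of_mem_iu (S.p_le_iu hv)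
  have h1 : (ζ : V →L[ℂ] V) ≠ 0 := fun h => h0 (by rw [h, smul_zero])
  have h2 := S.B_neg ζ ζ.2 h1
  rw [map_smul, map_smul, LinearMap.smul_apply, smul_smul, Complex.I_mul_I, neg_smul, one_smul,
    Complex.neg_re]
  linarith

theorem continuous_B_self : Continuous fun v : V →L[ℂ] V => S.B v v :=
  S.B.toContinuousBilinearMap.continuous.clm_apply continuous_id

theorem exists_norm_le_normP : ∃ C : ℝ, 0 ≤ C ∧ ∀ v ∈ S.p, ‖v‖ ≤ C * S.normP v := by
  have : ProperSpace S.p := FiniteDimensional.proper ℝ S.p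
  have hc : Continuous fun v : S.p => S.normP v :=
    Real.continuous_sqrt.comp (Complex.continuous_re.comp
      (S.continuous_B_self.comp continuous_subtype_val))
  have hp : ∀ v : S.p, v ≠ 0 → 0 < S.normP v := fun v hv =>
    Real.sqrt_pos.2 (S.re_B_pos v.2 fun h => hv (Subtype.ext h))
  have hh : ∀ (r : ℝ) (v : S.p), 0 ≤ r → S.normP (r • v : S.p) = r * S.normP v := by
    intro r v hr
    unfold normP
    rw [Submodule.coe_smul, ← Complex.coe_smul, map_smul, map_smul, LinearMap.smul_apply,
      smul_smul, smul_eq_mul, ← Complex.ofReal_mul, Complex.re_ofReal_mul,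
      Real.sqrt_mul (mul_self_nonneg r), Real.sqrt_mul_self hr]
  rcases (Metric.sphere (0 : S.p) 1).eq_empty_or_nonempty with he | hne
  -- An empty unit sphere means `𝔭 = 0`.
  · refine ⟨0, le_rfl, fun v hv => ?_⟩
    rw [zero_mul, norm_le_zero_iff]
    by_contra h
    have hn : ‖v‖ ≠ 0 := norm_ne_zero_iff.2 h
    have : (‖v‖⁻¹ • (⟨v, hv⟩ : S.p)) ∈ Metric.sphere (0 : S.p) 1 := by
      rw [mem_sphere_zero_iff_norm]
      change ‖‖v‖⁻¹ • v‖ = 1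
      rw [norm_smul, norm_inv, norm_norm]
      exact inv_mul_cancel₀ hn
    rw [he] at this
    exact this
  · obtain ⟨w, hw, hmin⟩ := (isCompact_sphere (0 : S.p) 1).exists_isMinOn hne hc.continuousOn
    have hw0 : 0 < S.normP w := hp w (ne_zero_of_mem_unit_sphere (⟨w, hw⟩ : Metric.sphere _ _))
    refine ⟨(S.normP w)⁻¹, (inv_pos.2 hw0).le, fun v hv => ?_⟩
    by_cases h : v = 0
    · rw [h, norm_zero]
      exact mul_nonneg (inv_pos.2 hw0).le (Real.sqrt_nonneg _)
    have hn : ‖v‖ ≠ 0 := norm_ne_zero_iff.2 h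
    have h1 : (‖v‖⁻¹ • (⟨v, hv⟩ : S.p)) ∈ Metric.sphere (0 : S.p) 1 := by
      rw [mem_sphere_zero_iff_norm]
      change ‖‖v‖⁻¹ • v‖ = 1
      rw [norm_smul, norm_inv, norm_norm]
      exact inv_mul_cancel₀ hn
    have h2 : S.normP w ≤ S.normP (‖v‖⁻¹ • (⟨v, hv⟩ : S.p) : S.p) := hmin h1
    rw [hh _ _ (by positivity)] at h2
    rw [inv_mul_eq_div, le_div_iff₀ hw0]
    calc ‖v‖ * S.normP w ≤ ‖v‖ * (‖v‖⁻¹ * S.normP v) := by gcongr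
      _ = S.normP v := by rw [← mul_assoc, mul_inv_cancel₀ hn, one_mul]

theorem norm_endG_inv_mul_le_of_mk_eq {a b a' b' : S.G}
    (ha : (QuotientGroup.mk a' : S.M) = QuotientGroup.mk a)
    (hb : (QuotientGroup.mk b' : S.M) = QuotientGroup.mk b) :
    ‖S.endG (a⁻¹ * b)‖ ≤ ‖S.endG (a'⁻¹ * b')‖ := by
  have ha' := QuotientGroup.eq.1 ha.symm
  have hb' := QuotientGroup.eq.1 hb
  have e : S.endG (a⁻¹ * b) = S.endG (a⁻¹ * a') * S.endG (a'⁻¹ * b') * S.endG (b'⁻¹ * b) := by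
    have : a⁻¹ * b = a⁻¹ * a' * (a'⁻¹ * b') * (b'⁻¹ * b) := by group
    rw [this]; rfl
  rw [e]
  calc _ ≤ ‖S.endG (a⁻¹ * a')‖ * ‖S.endG (a'⁻¹ * b')‖ * ‖S.endG (b'⁻¹ * b)‖ :=
        (norm_mul_le _ _).trans (mul_le_mul_of_nonneg_right (norm_mul_le _ _) (norm_nonneg _))
    _ ≤ 1 * ‖S.endG (a'⁻¹ * b')‖ * 1 := by
        gcongr
        · exact S.norm_endG_le_one ha'
        · exact S.norm_endG_le_one hb'
    _ = _ := by ring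

/-- A horizontal curve solves `c' = c v` with `v` its velocity, so Grönwall bounds `c(0)⁻¹c(1)` by
the exponential of a multiple of its length. -/
theorem exists_norm_le_of_distM_le (Q : ℝ≥0) : ∃ R : ℝ, ∀ a b : S.G,
    S.distM (QuotientGroup.mk a) (QuotientGroup.mk b) ≤ Q →
    ‖S.endG (a⁻¹ * b)‖ ≤ Real.exp R ∧ ‖S.endG (b⁻¹ * a)‖ ≤ Real.exp R := by
  have hV : CompleteSpace V := FiniteDimensional.complete ℂ V
  obtain ⟨C, hC0, hC⟩ := S.exists_norm_le_normP
  -- The infimum of lengths need not be attained, but some curve has length below `Q + 1`.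
  refine ⟨C * (Q + 1), fun a b hab => ?_⟩
  have h1 : S.distM (QuotientGroup.mk a) (QuotientGroup.mk b) < (Q : ℝ≥0∞) + 1 :=
    hab.trans_lt (ENNReal.lt_add_right ENNReal.coe_ne_top one_ne_zero)
  unfold distM at h1
  simp only [iInf_lt_iff] at h1
  obtain ⟨c, hc, hv, hc0, hc1, hint⟩ := h1
  set E : ℝ → (V →L[ℂ] V) := fun t => S.endG (c t) with hE
  have hEd : ∀ t, HasDerivAt E (E t * S.velocity c t) t := fun t => by
    have h2 := (hc.differentiable one_ne_zero t).hasDerivAt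
    refine h2.congr_deriv ?_
    unfold velocity
    rw [← mul_assoc]
    simp only [hE]
    rw [Units.mul_inv, one_mul]
  have hinv : Continuous fun t => S.endG (c t)⁻¹ := by
    refine continuous_iff_continuousAt.2 fun t => ?_
    have h2 := (NormedRing.inverse_continuousAt (c t : (V →L[ℂ] V)ˣ)).comp
      (f := E) hc.continuous.continuousAt
    refine h2.congr (Eventually.of_forall fun s => ?_)
    exact Ring.inverse_unit (c s : (V →L[ℂ] V)ˣ)
  have hvc : Continuous fun t => S.velocity c t :=
    hinv.mul (hc.continuous_deriv le_rfl)
  have hle : ∫ t in (0 : ℝ)..1, ‖S.velocity c t‖ ≤ C * (Q + 1) := by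
    rw [intervalIntegral.integral_of_le zero_le_one, ← integral_Icc_eq_integral_Ioc]
    have hi : IntegrableOn (fun t => ‖S.velocity c t‖) (Icc 0 1) :=
      hvc.norm.integrableOn_Icc
    have h3 : ENNReal.ofReal (∫ t in Icc (0 : ℝ) 1, ‖S.velocity c t‖)
        ≤ ENNReal.ofReal (C * (Q + 1)) := by
      rw [ofReal_integral_eq_lintegral_ofReal hi (Eventually.of_forall fun t => norm_nonneg _)]
      calc ∫⁻ t in Icc (0 : ℝ) 1, ENNReal.ofReal ‖S.velocity c t‖
          ≤ ∫⁻ t in Icc (0 : ℝ) 1, ENNReal.ofReal C *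
            ENNReal.ofReal (S.normP (S.velocity c t)) := by
            refine lintegral_mono fun t => ?_
            rw [← ENNReal.ofReal_mul hC0]
            exact ENNReal.ofReal_le_ofReal (hC _ (hv t))
        _ = ENNReal.ofReal C * ∫⁻ t in Icc (0 : ℝ) 1,
            ENNReal.ofReal (S.normP (S.velocity c t)) :=
            lintegral_const_mul' _ _ ENNReal.ofReal_ne_top
        _ ≤ ENNReal.ofReal C * ((Q : ℝ≥0∞) + 1) := by gcongr
        _ = ENNReal.ofReal (C * (Q + 1)) := by
            rw [ENNReal.ofReal_mul hC0, ENNReal.ofReal_add Q.coe_nonneg zero_le_one,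
              ENNReal.ofReal_coe_nnreal, ENNReal.ofReal_one]
    exact (ENNReal.ofReal_le_ofReal_iff (by positivity)).1 h3
  have h1E : ∀ t, ‖S.endG (c t)⁻¹ * E t‖ ≤ 1 := fun t => by
    rw [S.endG_inv_mul]; exact ContinuousLinearMap.norm_id_le
  constructor
  · refine (S.norm_endG_inv_mul_le_of_mk_eq hc0 hc1).trans ?_
    have h4 := norm_le_mul_exp_integral (f := fun t => S.endG (c 0)⁻¹ * E t)
      (fun t => (hEd t).const_mul _) hvc.norm
      (fun t => by rw [← mul_assoc]; exact norm_mul_le _ _)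
    refine h4.trans ?_
    have := mul_le_mul (h1E 0) (Real.exp_le_exp.2 hle) (Real.exp_nonneg _) zero_le_one
    rwa [one_mul] at this
  · refine (S.norm_endG_inv_mul_le_of_mk_eq hc1 hc0).trans ?_
    -- The inverse is bounded by running the curve backwards.
    have hrev : ∀ t : ℝ, HasDerivAt (fun t => S.endG (c 1)⁻¹ * E (1 - t))
        (S.endG (c 1)⁻¹ * (-(E (1 - t) * S.velocity c (1 - t)))) t := fun t => by
      have h5 := (hEd (1 - t)).scomp t ((hasDerivAt_id' t).const_sub 1)
      rw [neg_one_smul] at h5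
      exact h5.const_mul _
    have h4 := norm_le_mul_exp_integral hrev (n := fun t => ‖S.velocity c (1 - t)‖)
      (hvc.norm.comp (by fun_prop))
      (fun t => by rw [mul_neg, norm_neg, ← mul_assoc]; exact norm_mul_le _ _)
    rw [intervalIntegral.integral_comp_sub_left (fun t => ‖S.velocity c t‖) 1] at h4
    simp only [sub_self, sub_zero] at h4
    refine h4.trans ?_
    have := mul_le_mul (h1E 1) (Real.exp_le_exp.2 hle) (Real.exp_nonneg _) zero_le_one
    rwa [one_mul] at this

end CompatibleGroup

end

/-! ### Convexity along geodesics and comparison of asymptotic slopes. -/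

section

variable {V : Type*} [NormedAddCommGroup V] [InnerProductSpace ℂ V] [FiniteDimensional ℂ V]
  [CompleteSpace V]

namespace HamiltonianKahler

variable {S : CompatibleGroup V} {E Z : Type*} [NormedAddCommGroup E] [NormedSpace ℂ E]
  [TopologicalSpace Z] [ChartedSpace E Z] [IsManifold 𝓘(ℂ, E) ω Z] [MulAction S.UC Z]
  (H : HamiltonianKahler S E Z)

/-- The derivative at time `t` of the Kempf–Ness function along the geodesic
`t ↦ g exp (t β) K`. -/
def slope (x : Z) (g : S.G) (β : S.p) (t : ℝ) : ℝ :=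
  -H.grad (S.expI ((-t) • S.ofP β) • H.act g⁻¹ x) β

theorem hasDerivAt_kempfNess (x : Z) (g : S.G) (β : S.p) (t : ℝ) :
    HasDerivAt (fun t => H.kempfNess x (S.expG β (-t) * g⁻¹)) (H.slope x g β t) t := by
  have h1 := H.hasDerivAt_kempfNess_zero x (S.expG β (-t) * g⁻¹) β
  rw [act_mul, act_expG] at h1
  have h2 : HasDerivAt (fun r : ℝ => t - r) (-1) t := (hasDerivAt_id' t).const_sub t
  rw [← sub_self t] at h1
  have h3 := h1.comp t h2
  rw [mul_neg_one] at h3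
  refine h3.congr_of_eventuallyEq (Eventually.of_forall fun r => ?_)
  simp only [Function.comp]
  rw [← mul_assoc, ← S.expG_add]
  congr 3
  ring

theorem monotone_slope (x : Z) (g : S.G) (β : S.p) : Monotone (H.slope x g β) := by
  have h : Monotone fun t : ℝ => H.grad (S.expI (t • S.ofP β) • H.act g⁻¹ x) (S.ofP β) :=
    monotone_of_hasDerivAt_nonneg (fun t => H.hasDerivAt_grad_exp _ (S.ofP β) t)
      fun t => H.fundInner_self_nonneg _ _
  intro a b hab
  exact neg_le_neg (h (neg_le_neg hab))

theorem continuous_slope (x : Z) (g : S.G) (t : ℝ) : Continuous fun β => H.slope x g β t := by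
  have h := (H.contDiff_grad_expI (H.act g⁻¹ x)).continuous
  have h2 : Continuous fun β : S.p => ((S.ofP β, -t) : S.iu × ℝ) :=
    Continuous.prodMk (Continuous.subtype_mk continuous_subtype_val _) continuous_const
  exact (h.comp h2).neg

theorem hasDerivAt_kempfNessM_geodesic (x : Z) (g : S.G) (β : S.p) (t : ℝ) :
    HasDerivAt (fun t => H.kempfNessM x (S.geodesic g β t)) (H.slope x g β t) t := by
  have e : ∀ t, H.kempfNessM x (S.geodesic g β t) = H.kempfNess x (S.expG β (-t) * g⁻¹) := by
    intro t
    change H.kempfNess x (g * S.expG β t)⁻¹ = _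
    rw [mul_inv_rev, S.expG_inv]
  simp only [e]
  exact H.hasDerivAt_kempfNess x g β t

/-- The geodesics from a point to the points of a ray which stays at bounded distance from a ray
`t ↦ g' exp (t β') K` starting at that point converge to this ray. -/
theorem exists_tendsto_direction {g g' : S.G} {β β' : S.p} {R : ℝ}
    (hR : ∀ t : ℝ, 0 < t →
      ‖S.endG ((g * S.expG β t)⁻¹ * (g' * S.expG β' t))‖ ≤ Real.exp R ∧
      ‖S.endG ((g' * S.expG β' t)⁻¹ * (g * S.expG β t))‖ ≤ Real.exp R) (x : Z) :
    ∃ η : ℝ → S.p, Tendsto η atTop (𝓝 β') ∧ ∀ t : ℝ, 0 < t →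
      H.kempfNess x (S.expG β (-t) * g⁻¹) = H.kempfNess x (S.expG (η t) (-t) * g'⁻¹) := by
  set P : ℝ → S.p := fun t => S.polar (S.expG β (-t) * g⁻¹ * g') with hP
  have hb : ∀ t : ℝ, 0 < t → ‖(P t : V →L[ℂ] V) + t • (β' : V →L[ℂ] V)‖ ≤ 3 * |R| := by
    intro t ht
    have h1 := S.norm_polar_sub_le (g := S.expG β (-t) * g⁻¹ * g') (k := 1) (k' := 1)
      (ξ := (-t) • β') (w := S.endG ((g * S.expG β t)⁻¹ * (g' * S.expG β' t)))
      (w' := S.endG ((g' * S.expG β' t)⁻¹ * (g * S.expG β t))) (abs_nonneg R)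
      S.K.one_mem S.K.one_mem ?_ ?_ ((hR t ht).1.trans (Real.exp_le_exp.2 (le_abs_self R)))
      ((hR t ht).2.trans (Real.exp_le_exp.2 (le_abs_self R)))
    · rwa [Submodule.coe_smul, neg_smul, sub_neg_eq_add] at h1
    · have e : ((g' * S.expG β' t)⁻¹ * (g * S.expG β t))
          * ((g * S.expG β t)⁻¹ * (g' * S.expG β' t)) = 1 := by group
      exact congrArg S.endG e
    · have e : S.expG β (-t) * g⁻¹ * g' = 1 * ((g * S.expG β t)⁻¹ * (g' * S.expG β' t)) * 1
          * S.expG β' (-t) := by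
        rw [← S.expG_inv, ← S.expG_inv]; group
      exact congrArg S.endG e
  -- Chosen so that `exp(-tη_t) = exp(P t)`, that is `g' exp(tη_t)K = g exp(tβ)K`. Dividing the
  -- bounded error of `P t` by `t` gives convergence to `β'`.
  refine ⟨fun t => (-t⁻¹) • P t, ?_, fun t ht => ?_⟩
  · rw [tendsto_iff_norm_sub_tendsto_zero]
    have hz : Tendsto (fun t : ℝ => 3 * |R| / t) atTop (𝓝 0) :=
      tendsto_const_nhds.div_atTop tendsto_id
    refine squeeze_zero' (Eventually.of_forall fun t => norm_nonneg _) ?_ hz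
    filter_upwards [eventually_gt_atTop 0] with t ht
    have e : (-t⁻¹) • (P t : V →L[ℂ] V) - β'
        = (-t⁻¹) • ((P t : V →L[ℂ] V) + t • (β' : V →L[ℂ] V)) := by
      rw [smul_add, smul_smul, neg_mul, inv_mul_cancel₀ ht.ne', neg_one_smul, sub_eq_add_neg]
    change ‖(-t⁻¹) • (P t : V →L[ℂ] V) - β'‖ ≤ _
    rw [e, norm_smul, norm_neg, norm_inv, Real.norm_of_nonneg ht.le, inv_mul_eq_div]
    gcongr
    exact hb t ht
  · obtain ⟨k, hk, hkP⟩ := S.polar_spec (S.expG β (-t) * g⁻¹ * g')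
    have e1 : S.expG ((-t⁻¹) • P t) (-t) = S.expG (P t) 1 := by
      ext1
      change expU ((-t) • ((-t⁻¹) • (P t : V →L[ℂ] V))) = expU ((1 : ℝ) • (P t : V →L[ℂ] V))
      rw [smul_smul, neg_mul_neg, mul_inv_cancel₀ ht.ne']
    have e2 : S.expG β (-t) * g⁻¹ = k * (S.expG (P t) 1 * g'⁻¹) := by
      rw [← mul_assoc, ← hkP, mul_inv_cancel_right]
    rw [e1, e2, H.kempfNess_mul_left x k hk]

/-- Convexity along `g' exp(·η_t)K`, which reaches the other ray at time `t`, bounds `Φ_x` there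
from below. For fixed `r` the slope at `r` depends continuously on the direction, so the bound
survives `t → ∞`. -/
theorem iSup_slope_le {g g' : S.G} {β β' : S.p} {R : ℝ}
    (hR : ∀ t : ℝ, 0 < t →
      ‖S.endG ((g * S.expG β t)⁻¹ * (g' * S.expG β' t))‖ ≤ Real.exp R ∧
      ‖S.endG ((g' * S.expG β' t)⁻¹ * (g * S.expG β t))‖ ≤ Real.exp R) (x : Z) :
    ⨆ t, (H.slope x g' β' t : EReal) ≤ ⨆ t, (H.slope x g β t : EReal) := by
  obtain ⟨η, hη, hηx⟩ := H.exists_tendsto_direction hR x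
  refine iSup_le fun s => ?_
  -- Nonnegative times suffice by monotonicity, and `[0, r]` and `[r, t]` are then intervals.
  have hs : H.slope x g' β' s ≤ H.slope x g' β' (max s 0) :=
    H.monotone_slope x g' β' (le_max_left _ _)
  refine (EReal.coe_le_coe_iff.2 hs).trans ?_
  obtain ⟨r, hr0, hr⟩ : ∃ r, 0 ≤ r ∧ r = max s 0 := ⟨_, le_max_right _ _, rfl⟩
  rw [← hr]
  have hlim := (tendsto_slope_of_monotone_deriv (H.hasDerivAt_kempfNess x g β)
    (H.monotone_slope x g β)).2
  set c := H.kempfNess x g'⁻¹ with hc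
  have hsl : ∀ r, Tendsto (fun t => H.slope x g' (η t) r) atTop (𝓝 (H.slope x g' β' r)) := fun r =>
    ((H.continuous_slope x g' r).tendsto β').comp hη
  have hinv : Tendsto (fun t : ℝ => t⁻¹) atTop (𝓝 0) := tendsto_inv_atTop_zero
  -- The lower bound divided by `t`: slope at `0` on `[0, r]` and slope at `r` on `[r, t]`.
  have hlow : Tendsto (fun t : ℝ => (c + H.slope x g' (η t) 0 * r - H.slope x g' (η t) r * r) * t⁻¹
      + H.slope x g' (η t) r) atTop (𝓝 (H.slope x g' β' r)) := by
    have h := ((((hsl 0).mul_const r).const_add c).sub ((hsl r).mul_const r)).mul hinv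
    simpa using h.add (hsl r)
  have hlow' := (continuous_coe_real_ereal.tendsto _).comp hlow
  refine le_of_tendsto_of_tendsto hlow' hlim ?_
  filter_upwards [eventually_gt_atTop 0, eventually_ge_atTop r] with t ht hrt
  refine EReal.coe_le_coe_iff.2 ?_
  rw [hηx t ht]
  have hd := H.hasDerivAt_kempfNess x g' (η t)
  have hm := H.monotone_slope x g' (η t)
  have b1 := (sub_bounds_of_monotone_deriv hd hm hr0).1
  have b2 := (sub_bounds_of_monotone_deriv hd hm hrt).1
  simp only [neg_zero, S.expG_zero, one_mul] at b1
  change (c + H.slope x g' (η t) 0 * r - H.slope x g' (η t) r * r) * t⁻¹ + H.slope x g' (η t) r ≤ _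
  rw [← div_eq_mul_inv (_ - _) t, div_add' _ _ _ ht.ne']
  gcongr
  linarith

end HamiltonianKahler

end

end KempfNess

end

/-! The asymptotic slopes of equivalent geodesics agree by convexity and continuity of the
Kempf–Ness function alone: the geodesics from `γ' 0` to `γ t` converge to `γ'` as `t → ∞`. The
growth condition on `X` is therefore not needed. -/

theorem mainTheorem3
    {V : Type*} [NormedAddCommGroup V] [InnerProductSpace ℂ V] [FiniteDimensional ℂ V]
    (S : KempfNess.CompatibleGroup V)
    {E Z : Type*} [NormedAddCommGroup E] [NormedSpace ℂ E] [FiniteDimensional ℂ E]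
    [TopologicalSpace Z] [T2Space Z] [ChartedSpace E Z] [IsManifold 𝓘(ℂ, E) ω Z]
    [MulAction S.UC Z] (H : KempfNess.HamiltonianKahler S E Z)
    (X : Set Z) (hX : KempfNess.IsRealSubmanifold E X)
    (hGX : ∀ (g : S.G), ∀ x ∈ X, H.act g x ∈ X)
    (hA : H.LinearGrowth X) (x : Z) (hx : x ∈ X) :
    (∀ γ : S.UnitGeodesic, Differentiable ℝ (fun t : ℝ => H.kempfNessM x (γ.1 t))) ∧
    ∃! lam : S.TitsBoundary → EReal, ∀ γ : S.UnitGeodesic,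
      lam (Quot.mk _ γ) ≠ ⊥ ∧
      Tendsto (fun t : ℝ => ((deriv (fun s : ℝ => H.kempfNessM x (γ.1 s)) t : ℝ) : EReal)) atTop
        (𝓝 (lam (Quot.mk _ γ))) ∧
      Tendsto (fun t : ℝ => ((H.kempfNessM x (γ.1 t) / t : ℝ) : EReal)) atTop
        (𝓝 (lam (Quot.mk _ γ))) := by
  have hV : CompleteSpace V := FiniteDimensional.complete ℂ V
  have hderiv : ∀ (g : S.G) (β : S.p), deriv (fun t => H.kempfNessM x (S.geodesic g β t))
      = H.slope x g β := fun g β =>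
    funext fun t => (H.hasDerivAt_kempfNessM_geodesic x g β t).deriv
  refine ⟨?_, Quot.lift (fun γ : S.UnitGeodesic =>
    ⨆ t, ((deriv (fun s : ℝ => H.kempfNessM x (γ.1 s)) t : ℝ) : EReal)) ?_, ?_, ?_⟩
  · rintro ⟨_, g, β, -, rfl⟩ t
    exact (H.hasDerivAt_kempfNessM_geodesic x g β t).differentiableAt
  · rintro ⟨_, g, β, _, rfl⟩ ⟨_, g', β', _, rfl⟩ ⟨Q, hQ⟩
    obtain ⟨R, hR⟩ := S.exists_norm_le_of_distM_le Q
    have hb := fun (t : ℝ) (ht : 0 < t) => hR (g * S.expG β t) (g' * S.expG β' t) (hQ t ht)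
    simp only [hderiv]
    exact le_antisymm (H.iSup_slope_le (fun t ht => (hb t ht).symm) x) (H.iSup_slope_le hb x)
  · rintro ⟨_, g, β, -, rfl⟩
    have h := KempfNess.tendsto_slope_of_monotone_deriv (H.hasDerivAt_kempfNessM_geodesic x g β)
      (H.monotone_slope x g β)
    simp only [hderiv]
    refine ⟨ne_of_gt ?_, h⟩
    exact (EReal.bot_lt_coe (H.slope x g β 0)).trans_le
      (le_iSup (fun t => (H.slope x g β t : EReal)) 0)
  -- Every class has a representative, and limits in `EReal` are unique.
  · intro lam hlam
    funext q
    induction q using Quot.ind with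
    | mk γ =>
      refine tendsto_nhds_unique (hlam γ).2.1 ?_
      obtain ⟨_, g, β, -, rfl⟩ := γ
      have h := KempfNess.tendsto_slope_of_monotone_deriv
        (H.hasDerivAt_kempfNessM_geodesic x g β) (H.monotone_slope x g β)
      simp only [hderiv]
      exact h.1
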